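/- For a unit vector $\mathbf n\in\mathbb R^3$ let $|\mathbf n\rangle$ be the pure qubit state with Bloch vector $\mathbf n$, and for $p\in(1/2,1)$ let $$\rho_{\mathbf n}=p\,|\mathbf n\rangle\langle\mathbf n|+(1-p)\,|-\mathbf n\rangle\langle-\mathbf n| .$$ A complete qubit ensemble with known purity is given by a number $p\in(1/2,1)$ and a Borel probability measure $\mu$ on the unit sphere that gives positive measure to every non-empty open set; its $N$-copy version consists of the states $\rho_{\mathbf n}^{\otimes N}$ with $\mathbf n$ distributed according to $\mu$. It is encoded into $n$ qubits by a pair of quantum channels (completely positive trace-preserving maps) $\mathcal E$, from $N$ to $n$ qubits, and $\mathcal D$, from $n$ to $N$ qubits; the error is $$e_N=\int \tfrac12\bigl\|\rho_{\mathbf n}^{\otimes N}-\mathcal D\circ\mathcal E(\rho_{\mathbf n}^{\otimes N})\bigr\|\,d\mu(\mathbf n),$$ with $\|\cdot\|$ the trace norm. **Theorem.** For every $0<\epsilon<2$ and every complete qubit ensemble $(p,\mu)$ there is an integer $N_0>0$ such that for every $N\ge N_0$ the $N$-copy ensemble can be encoded, with error $e_N<\epsilon$, into a whole number $n$ of qubits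 satisfying $$n\le \tfrac32\log_2 N+\log_2\Bigl[4(2p-1)\sqrt{\ln(2/\epsilon)}\Bigr].$$ Moreover the encoder can be chosen to keep only the sectors of total angular momentum $j\in\{N/2,N/2-1,\dots\}$, $j\ge0$, in the window $$\bigl|j-(p-\tfrac12)(N+1)\bigr|\le\sqrt{N\ln(2/\epsilon)} :$$ if $\Pi$ is the orthogonal projector onto the sum of these sectors, that is, of the eigenspaces of the square $J^2$ of the total angular momentum of the $N$ qubits for the eigenvalues $j(j+1)$, then $\mathcal E(X)=\mathcal E(\Pi X\Pi)+\mathrm{Tr}[(1-\Pi)X]\,\rho_0$ for every operator $X$, with a fixed state $\rho_0$ of the $n$ qubits. -/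

import Mathlib

open scoped Matrix ComplexOrder
open MeasureTheory

noncomputable section

/-- The computational-basis labels of a register of `n` qubits. The Hilbert space of the register is
`EuclideanSpace ℂ (Qubits n)`, of dimension `2 ^ n`. -/
abbrev Qubits (n : ℕ) : Type := Fin n → Fin 2

/-- The operators on a register of `n` qubits, as matrices in the computational basis. -/
abbrev Op (n : ℕ) : Type := Matrix (Qubits n) (Qubits n) ℂ

/-- The unit sphere of `ℝ³` (the sphere of Bloch vectors of pure qubit states). -/
abbrev BlochSphere : Type := Metric.sphere (0 : EuclideanSpace ℝ (Fin 3)) 1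

/-- The three Pauli matrices `σ_x`, `σ_y`, `σ_z`. -/
def pauli : Fin 3 → Matrix (Fin 2) (Fin 2) ℂ :=
  ![!![0, 1; 1, 0], !![0, -Complex.I; Complex.I, 0], !![1, 0; 0, -1]]

/-- The projector `|n⟩⟨n| = (1 + n · σ) / 2` onto the pure qubit state with Bloch vector `n`. -/
def pureState (n : EuclideanSpace ℝ (Fin 3)) : Matrix (Fin 2) (Fin 2) ℂ :=
  (1 / 2 : ℂ) • (1 + ∑ a, (n a : ℂ) • pauli a)

/-- The mixed qubit state `p |n⟩⟨n| + (1 - p) |-n⟩⟨-n|`. -/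
def qubitState (p : ℝ) (n : BlochSphere) : Matrix (Fin 2) (Fin 2) ℂ :=
  (p : ℂ) • pureState n.1 + ((1 - p : ℝ) : ℂ) • pureState (-n.1)

/-- The `N`-fold tensor power `A ⊗ ⋯ ⊗ A` of a single-qubit operator. -/
def tensorPower (N : ℕ) (A : Matrix (Fin 2) (Fin 2) ℂ) : Op N :=
  fun x y => ∏ i, A (x i) (y i)

/-- The trace norm `‖A‖ = Tr √(A† A)`: the sum of the singular values of `A`. -/
def traceNorm {ι : Type*} [Fintype ι] [DecidableEq ι] (A : Matrix ι ι ℂ) : ℝ :=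
  ∑ i, √((Matrix.isHermitian_conjTranspose_mul_self A).eigenvalues i)

/-- `ρ` is a quantum state (density matrix). -/
def IsState {ι : Type*} [Fintype ι] (ρ : Matrix ι ι ℂ) : Prop :=
  ρ.PosSemidef ∧ ρ.trace = 1

/-- The map `id ⊗ Φ` on operators on `ℂᵏ ⊗ ℂ^ι`. -/
def ampliation {ι κ : Type*} (Φ : Matrix ι ι ℂ →ₗ[ℂ] Matrix κ κ ℂ) (k : ℕ)
    (X : Matrix (Fin k × ι) (Fin k × ι) ℂ) : Matrix (Fin k × κ) (Fin k × κ) ℂ :=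
  fun a b => Φ (fun x y => X (a.1, x) (b.1, y)) a.2 b.2

/-- A quantum channel: a completely positive trace-preserving linear map. -/
structure IsChannel {ι κ : Type*} [Fintype ι] [Fintype κ]
    (Φ : Matrix ι ι ℂ →ₗ[ℂ] Matrix κ κ ℂ) : Prop where
  tracePreserving : ∀ X, (Φ X).trace = X.trace
  completelyPositive : ∀ (k : ℕ) (X : Matrix (Fin k × ι) (Fin k × ι) ℂ),
    X.PosSemidef → (ampliation Φ k X).PosSemidef

/-- The average error of the compression protocol with encoder `E` and decoder `D` on the ensemble of
the states `(qubitState p n) ^ ⊗ N`, the Bloch vector `n` being drawn from `μ`. (The integrand is a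
continuous function on the compact sphere.) -/
def averageError (p : ℝ) (μ : Measure BlochSphere) {N n : ℕ}
    (E : Op N →ₗ[ℂ] Op n) (D : Op n →ₗ[ℂ] Op N) : ℝ :=
  ∫ v, traceNorm (tensorPower N (qubitState p v) - D (E (tensorPower N (qubitState p v)))) / 2 ∂μ

/-- The operator acting as `A` on the `i`-th qubit and as the identity on the others. -/
def onSite {N : ℕ} (i : Fin N) (A : Matrix (Fin 2) (Fin 2) ℂ) : Op N :=
  fun x y => if ∀ k, k ≠ i → x k = y k then A (x i) (y i) else 0

/-- The components `J_a = ∑ᵢ σ_a⁽ⁱ⁾ / 2` of the total angular momentum of `N` qubits. -/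
def totalSpin (N : ℕ) (a : Fin 3) : Op N :=
  ∑ i, onSite i ((1 / 2 : ℂ) • pauli a)

/-- The square `J² = J_x² + J_y² + J_z²` of the total angular momentum. -/
def totalSpinSq (N : ℕ) : Op N :=
  ∑ a, totalSpin N a * totalSpin N a

/-- The sector of total angular momentum `j`: the eigenspace of `J²` for the eigenvalue
`j (j + 1)`. -/
def spinSector (N : ℕ) (j : ℝ) : Submodule ℂ (EuclideanSpace ℂ (Qubits N)) :=
  Module.End.eigenspace (Matrix.toEuclideanLin (totalSpinSq N)) ((j * (j + 1) : ℝ) : ℂ)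

/-- The quantum numbers `j = N/2, N/2 - 1, …` (down to `0` or `1/2`) of the total angular momentum of
`N` qubits that are at distance at most `w` from `c`. -/
def spinWindow (N : ℕ) (c w : ℝ) : Set ℝ :=
  {j | (∃ k : ℕ, 2 * k ≤ N ∧ j = (N : ℝ) / 2 - k) ∧ |j - c| ≤ w}

/-- The orthogonal projector onto the sum of the sectors of total angular momentum `j ∈ S`. -/
def sectorProjector (N : ℕ) (S : Set ℝ) : Op N :=
  Matrix.toEuclideanLin.symm
    ((⨆ j ∈ S, spinSector N j).starProjection :
      EuclideanSpace ℂ (Qubits N) →L[ℂ] EuclideanSpace ℂ (Qubits N)).toLinearMap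

/-- The encoder `E` keeps only the sectors `j ∈ S`: the part of the input outside of these sectors is
discarded and replaced by a fixed state `ρ₀` of the encoding system. -/
def KeepsOnlySectors {N n : ℕ} (S : Set ℝ) (E : Op N →ₗ[ℂ] Op n) : Prop :=
  ∃ ρ₀ : Op n, IsState ρ₀ ∧ ∀ X : Op N,
    E X = E (sectorProjector N S * X * sectorProjector N S)
      + ((1 - sectorProjector N S) * X).trace • ρ₀

end

/-! On each irreducible component of the collective spin, `ρ^⊗N` acts in the same way on all copies:
it is block diagonal over the sectors `j = N/2 - k`, with blocks (spin matrix) ⊗ (identity on the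
multiplicity space). The multiplicity carries no information, so the encoder traces it out and the
decoder restores it maximally mixed. What must be stored is `∑ (2j+1)` dimensions over the kept
sectors, and the error is at most the probability of the discarded ones (`exists_compression`).

The representation theory is done by hand. Partial isometries `ladder N k i`, proportional to `J₋^i`
on the highest-weight vectors, are orthonormal in the sense of `ladder_conjTranspose_mul` and span
everything (`ladderProj_eq_one`). The state is a polynomial in one spin component, so it acts on the
ladders by scalars (`tensorPower_mem_spinAlgebra`, `spinAlgebra_le_ladderSubalgebra`). The
multiplicities are never computed: the generating identity `sum_sectorMultiplicity_mul` gives a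
moment generating function, and Hoeffding's lemma then gives Chernoff tails around `j ≈ (p - 1/2)
N`.

Keeping `|j - c| ≤ a √(N L)`, with `L = ln (2/ε)` and `c = (p - 1/2)(N + 1)`, costs an error tending
to `2 exp (-2 a² L)` and about `2 a (2p - 1) √L N^(3/2)` dimensions. The error target `2 exp (-L) =
ε` needs `a > 1/√2`. Rounding to whole qubits can halve the allowed `4 (2p - 1) √L N^(3/2)`, so the
dimension needs `a < 1`. The choice `a = 3/4` leaves strict room on both sides, which absorbs all
lower-order terms for large `N`. -/

noncomputable section

/-! ### Trace norm of Hermitian matrices. -/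

open Polynomial in
lemma traceNorm_of_isHermitian {ι : Type*} [Fintype ι] [DecidableEq ι] {A : Matrix ι ι ℂ}
    (hA : A.IsHermitian) : traceNorm A = ∑ i, |hA.eigenvalues i| := by
  have hB := Matrix.isHermitian_conjTranspose_mul_self A
  have h1 : (Aᴴ * A).charpoly = ∏ i, (X - C (((hA.eigenvalues i) ^ 2 : ℝ) : ℂ)) := by
    have hs : Aᴴ * A = Unitary.conjStarAlgAut ℂ _ hA.eigenvectorUnitary
        (Matrix.diagonal (fun i => (((hA.eigenvalues i) ^ 2 : ℝ) : ℂ))) := by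
      have : Matrix.diagonal (fun i => (((hA.eigenvalues i) ^ 2 : ℝ) : ℂ)) =
          Matrix.diagonal (RCLike.ofReal ∘ hA.eigenvalues) *
          Matrix.diagonal (RCLike.ofReal ∘ hA.eigenvalues) := by
        rw [Matrix.diagonal_mul_diagonal]
        congr 1
        ext i
        simp [sq]
      rw [this, map_mul, ← hA.spectral_theorem, hA.eq]
    rw [hs, Unitary.conjStarAlgAut_apply, Matrix.charpoly_mul_comm, ← mul_assoc]
    simp [Matrix.charpoly_diagonal]
  have h2 : (Aᴴ * A).charpoly.roots =
      Multiset.map (fun i => (((hA.eigenvalues i) ^ 2 : ℝ) : ℂ)) Finset.univ.val := by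
    rw [h1, Polynomial.roots_prod _ _
      (Finset.prod_ne_zero_iff.2 fun _ _ => Polynomial.X_sub_C_ne_zero _)]
    simp only [Polynomial.roots_X_sub_C, Multiset.bind_singleton]
  have h3 := hB.roots_charpoly_eq_eigenvalues
  rw [h2] at h3
  -- The two eigenvalue families agree only as multisets of roots, not index by index, so square
  -- roots are summed over the multisets.
  have h4 := congrArg (fun s => (Multiset.map (fun z : ℂ => √ z.re) s).sum) h3
  simp only [Multiset.map_map, Function.comp_def] at h4
  unfold traceNorm
  have h5 : ∀ i, |hA.eigenvalues i| = √ ((((hA.eigenvalues i) ^ 2 : ℝ) : ℂ)).re := by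
    intro i
    rw [Complex.ofReal_re, Real.sqrt_sq_eq_abs]
  rw [Finset.sum_congr rfl (fun i _ => h5 i)]
  exact h4.symm

/-- In an eigenbasis of `P - Q` every eigenvalue is a difference of two non-negative diagonal
entries, so its modulus is at most their sum. -/
lemma traceNorm_sub_le {ι : Type*} [Fintype ι] [DecidableEq ι] {P Q : Matrix ι ι ℂ}
    (hP : P.PosSemidef) (hQ : Q.PosSemidef) :
    traceNorm (P - Q) ≤ P.trace.re + Q.trace.re := by
  have hA : (P - Q).IsHermitian := hP.1.sub hQ.1
  rw [traceNorm_of_isHermitian hA]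
  set U : Matrix ι ι ℂ := (hA.eigenvectorUnitary : Matrix ι ι ℂ) with hU
  have hUU : U * Uᴴ = 1 := Unitary.coe_mul_star_self hA.eigenvectorUnitary
  have hd : Uᴴ * (P - Q) * U = Matrix.diagonal (RCLike.ofReal ∘ hA.eigenvalues) := by
    have := hA.conjStarAlgAut_star_eigenvectorUnitary
    rw [Unitary.conjStarAlgAut_star_apply] at this
    exact this
  have htr : ∀ X : Matrix ι ι ℂ, X.trace = (Uᴴ * X * U).trace := by
    intro X
    rw [Matrix.trace_mul_comm, ← mul_assoc, hUU, one_mul]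
  rw [htr P, htr Q, ← Complex.add_re, ← Matrix.trace_add, Matrix.trace, Complex.re_sum]
  refine Finset.sum_le_sum fun i _ => ?_
  have hp := (hP.conjTranspose_mul_mul_same U).diag_nonneg (i := i)
  have hq := (hQ.conjTranspose_mul_mul_same U).diag_nonneg (i := i)
  have he := congrFun (congrFun hd i) i
  rw [mul_sub, sub_mul, Matrix.sub_apply, Matrix.diagonal_apply_eq] at he
  have he' := congrArg Complex.re he
  rw [Complex.sub_re, Function.comp_apply] at he'
  change _ = hA.eigenvalues i at he'
  rw [← he', Matrix.diag_apply, Matrix.add_apply, Complex.add_re, abs_le]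
  have hp' := (Complex.le_def.1 hp).1
  have hq' := (Complex.le_def.1 hq).1
  simp only [Complex.zero_re] at hp' hq'
  constructor <;> linarith

/-! ### Completely positive maps and measure-and-prepare maps. -/

/-- Complete positivity of a linear map between matrix algebras. -/
def IsCompletelyPositive {ι κ : Type*} [Fintype ι] [Fintype κ]
    (Φ : Matrix ι ι ℂ →ₗ[ℂ] Matrix κ κ ℂ) : Prop :=
  ∀ (k : ℕ) (X : Matrix (Fin k × ι) (Fin k × ι) ℂ),
    X.PosSemidef → (ampliation Φ k X).PosSemidef

namespace IsCompletelyPositive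

variable {ι κ m : Type*} [Fintype ι] [Fintype κ] [Fintype m]

lemma add {Φ Ψ : Matrix ι ι ℂ →ₗ[ℂ] Matrix κ κ ℂ} (h₁ : IsCompletelyPositive Φ)
    (h₂ : IsCompletelyPositive Ψ) : IsCompletelyPositive (Φ + Ψ) :=
  fun k X hX => (h₁ k X hX).add (h₂ k X hX)

lemma comp {Φ : Matrix ι ι ℂ →ₗ[ℂ] Matrix κ κ ℂ} {Ψ : Matrix κ κ ℂ →ₗ[ℂ] Matrix m m ℂ}
    (h₂ : IsCompletelyPositive Ψ) (h₁ : IsCompletelyPositive Φ) :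
    IsCompletelyPositive (Ψ ∘ₗ Φ) :=
  fun k X hX => h₂ k _ (h₁ k X hX)

/-- The ampliation has the Kraus operators `1 ⊗ K i`. -/
lemma of_kraus {s : Type*} [Fintype s] (K : s → Matrix κ ι ℂ)
    {Φ : Matrix ι ι ℂ →ₗ[ℂ] Matrix κ κ ℂ} (h : ∀ X, Φ X = ∑ i, K i * X * (K i)ᴴ) :
    IsCompletelyPositive Φ := by
  intro k X hX
  have : ampliation Φ k X = ∑ i, (Matrix.of fun (a : Fin k × κ) (b : Fin k × ι) =>
      if a.1 = b.1 then K i a.2 b.2 else 0) * X * (Matrix.of fun (a : Fin k × κ) (b : Fin k × ι) =>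
      if a.1 = b.1 then K i a.2 b.2 else 0)ᴴ := by
    ext a b
    change Φ (Matrix.of fun x y => X (a.1, x) (b.1, y)) a.2 b.2 = _
    rw [h]
    simp only [Matrix.sum_apply, Matrix.mul_apply, Matrix.conjTranspose_apply,
      Matrix.of_apply, Fintype.sum_prod_type, apply_ite star, star_zero, ite_mul, mul_ite, zero_mul,
      mul_zero]
    refine Finset.sum_congr rfl fun i _ => ?_
    rw [Finset.sum_eq_single b.1 (by intro c _ hc; simp [Ne.symm hc]) (by simp)]
    refine Finset.sum_congr rfl fun y _ => ?_
    simp only [if_true]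
    rw [Finset.sum_eq_single a.1 (by intro c _ hc; simp [Ne.symm hc]) (by simp)]
    simp
  rw [this]
  exact Matrix.posSemidef_sum _ fun i _ => hX.mul_mul_conjTranspose_same _

lemma map_posSemidef {Φ : Matrix ι ι ℂ →ₗ[ℂ] Matrix κ κ ℂ} (h : IsCompletelyPositive Φ)
    {X : Matrix ι ι ℂ} (hX : X.PosSemidef) : (Φ X).PosSemidef :=
  (h 1 _ (hX.submatrix Prod.snd)).submatrix (fun x => ((0 : Fin 1), x))

end IsCompletelyPositive

/-- The map `X ↦ Tr (Q X) • σ`. -/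
def measurePrepare {H M : Type*} [Fintype H] (Q : Matrix H H ℂ) (σ : Matrix M M ℂ) :
    Matrix H H ℂ →ₗ[ℂ] Matrix M M ℂ where
  toFun X := (Q * X).trace • σ
  map_add' X Y := by rw [mul_add, Matrix.trace_add, add_smul]
  map_smul' c X := by simp [mul_smul]

lemma measurePrepare_apply {H M : Type*} [Fintype H] (Q X : Matrix H H ℂ) (σ : Matrix M M ℂ) :
    measurePrepare Q σ X = (Q * X).trace • σ := rfl

/-- The rank-one projector on a computational basis vector. -/
def basisState {M : Type*} [DecidableEq M] (x : M) : Matrix M M ℂ := Matrix.single x x 1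

/-- The Kraus operators are `|x⟩⟨b| Q`, since `Tr (Q X) = ∑ b, (Q X Q) b b` for a projector `Q`. -/
lemma measurePrepare_basisState_cp {H M : Type*} [Fintype H] [Fintype M] [DecidableEq M]
    {Q : Matrix H H ℂ} (hQ : Qᴴ = Q) (hQ2 : Q * Q = Q) (x : M) :
    IsCompletelyPositive (measurePrepare Q (basisState x)) := by
  refine IsCompletelyPositive.of_kraus
    (fun b : H => Matrix.of fun y h => if y = x then Q b h else 0) fun X => ?_
  have h1 : (Q * X).trace = ∑ b, (Q * X * Q) b b := by
    rw [← Matrix.trace_mul_comm]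
    conv_lhs => rw [← hQ2, ← mul_assoc, Matrix.trace_mul_comm, ← mul_assoc]
    rfl
  ext y z
  rw [measurePrepare_apply, h1, basisState, Matrix.sum_apply, Matrix.smul_apply, Matrix.single_apply]
  by_cases hy : x = y
  · by_cases hz : x = z
    · subst hy; subst hz
      simp only [and_self, if_true, smul_eq_mul, mul_one]
      refine Finset.sum_congr rfl fun b _ => ?_
      conv_lhs => rw [← hQ]
      simp only [Matrix.mul_apply, Matrix.conjTranspose_apply, Matrix.of_apply, if_true]
      refine Finset.sum_congr rfl fun c _ => ?_
      congr 1
      refine Finset.sum_congr rfl fun d _ => ?_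
      conv_rhs => rw [← hQ]
      simp
    · simp [Matrix.mul_apply, hz, Ne.symm hz]
  · simp [Matrix.mul_apply, hy, Ne.symm hy]

lemma basisState_isState {M : Type*} [Fintype M] [DecidableEq M] (x : M) :
    IsState (basisState x) := by
  refine ⟨?_, by simp [basisState]⟩
  have : basisState x = Matrix.diagonal (Pi.single x (1 : ℂ)) := (Matrix.diagonal_single x 1).symm
  rw [this]
  refine Matrix.PosSemidef.diagonal ?_
  intro y
  by_cases h : y = x
  · subst h; simp
  · simp [h]

/-! ### The projector onto the ranges of orthogonal partial isometries. -/

section Projection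

lemma sum_mul_conjTranspose_isHermitian {H I : Type*} [Fintype H] [Fintype I]
    (F : I → Matrix H H ℂ) : (∑ a, F a * (F a)ᴴ)ᴴ = ∑ a, F a * (F a)ᴴ := by
  simp [Matrix.conjTranspose_sum]

variable {H I κ : Type*} [Fintype H] [Fintype I] [DecidableEq I]
  {π : I → κ} {F : I → Matrix H H ℂ} {P : κ → Matrix H H ℂ}

lemma sum_mul_conjTranspose_mul (hF : ∀ a b, (F a)ᴴ * F b = if a = b then P (π a) else 0)
    (hFP : ∀ a, F a * P (π a) = F a) (b : I) : (∑ a, F a * (F a)ᴴ) * F b = F b := by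
  rw [Finset.sum_mul, Finset.sum_eq_single b]
  · rw [mul_assoc, hF, if_pos rfl, hFP]
  · intro a _ ha
    rw [mul_assoc, hF, if_neg ha, mul_zero]
  · simp

lemma sum_mul_conjTranspose_mul_self
    (hF : ∀ a b, (F a)ᴴ * F b = if a = b then P (π a) else 0)
    (hFP : ∀ a, F a * P (π a) = F a) :
    (∑ a, F a * (F a)ᴴ) * (∑ a, F a * (F a)ᴴ) = ∑ a, F a * (F a)ᴴ := by
  conv_lhs => rw [Finset.mul_sum]
  refine Finset.sum_congr rfl fun b _ => ?_
  rw [← mul_assoc, sum_mul_conjTranspose_mul hF hFP]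

end Projection

/-! ### Tracing out and restoring the multiplicity spaces. -/

section Compression

variable {H M I κ : Type*} [Fintype H] [DecidableEq κ]

/-- The block-diagonal part of the matrix of the traces `Tr (F a)ᴴ X (F b)`. -/
def blockTrace (π : I → κ) (F : I → Matrix H H ℂ) : Matrix H H ℂ →ₗ[ℂ] Matrix I I ℂ where
  toFun X := Matrix.of fun a b => if π a = π b then ((F a)ᴴ * X * F b).trace else 0
  map_add' X Y := by
    ext a b
    by_cases h : π a = π b <;> simp [h, mul_add, add_mul]
  map_smul' c X := by
    ext a b
    by_cases h : π a = π b <;> simp [h]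

lemma blockTrace_apply (π : I → κ) (F : I → Matrix H H ℂ) (X : Matrix H H ℂ) (a b : I) :
    blockTrace π F X a b = if π a = π b then ((F a)ᴴ * X * F b).trace else 0 := rfl

variable [Fintype I]

/-- The map that prepares `F a (F b)ᴴ`, with weight `r ^ 2`, from the matrix unit `(a, b)` of a
diagonal block. -/
def blockPrepare (π : I → κ) (F : I → Matrix H H ℂ) (r : κ → ℝ) :
    Matrix I I ℂ →ₗ[ℂ] Matrix H H ℂ where
  toFun Z := ∑ a, ∑ b, (if π a = π b then (r (π a) : ℂ) ^ 2 * Z a b else 0) • (F a * (F b)ᴴ)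
  map_add' X Y := by
    simp only [← Finset.sum_add_distrib, ← add_smul]
    refine Finset.sum_congr rfl fun a _ => Finset.sum_congr rfl fun b _ => ?_
    by_cases h : π a = π b <;> simp [h, mul_add]
  map_smul' c X := by
    simp only [Finset.smul_sum, smul_smul, RingHom.id_apply]
    refine Finset.sum_congr rfl fun a _ => Finset.sum_congr rfl fun b _ => ?_
    by_cases h : π a = π b <;> simp [h, mul_left_comm]

lemma blockPrepare_apply (π : I → κ) (F : I → Matrix H H ℂ) (r : κ → ℝ) (Z : Matrix I I ℂ) :
    blockPrepare π F r Z =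
      ∑ a, ∑ b, (if π a = π b then (r (π a) : ℂ) ^ 2 * Z a b else 0) • (F a * (F b)ᴴ) := rfl

/-- A Kraus index is a block together with a basis vector of the traced space. Including the block
in the index is what removes the coherences between blocks. -/
lemma blockTrace_cp [Fintype κ] (π : I → κ) (F : I → Matrix H H ℂ) :
    IsCompletelyPositive (blockTrace π F) := by
  refine IsCompletelyPositive.of_kraus (fun s : κ × H =>
    Matrix.of fun a h => if π a = s.1 then star (F a h s.2) else 0) fun X => ?_
  ext a b
  rw [blockTrace_apply, Matrix.sum_apply, Fintype.sum_prod_type]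
  simp only [Matrix.mul_apply, Matrix.conjTranspose_apply, Matrix.of_apply, apply_ite star,
    star_zero, ite_mul, mul_ite, zero_mul, mul_zero, star_star, Finset.sum_ite_irrel,
    Finset.sum_const_zero]
  rw [Finset.sum_eq_single (π b) (by intro k _ hk; simp [Ne.symm hk]) (by simp)]
  by_cases h : π a = π b
  · simp [h, Matrix.trace, Matrix.mul_apply]
  · simp [h]

lemma blockPrepare_cp [Fintype κ] (π : I → κ) (F : I → Matrix H H ℂ) (r : κ → ℝ) :
    IsCompletelyPositive (blockPrepare π F r) := by
  refine IsCompletelyPositive.of_kraus (fun s : κ × H =>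
    Matrix.of fun h a => if π a = s.1 then r s.1 * F a h s.2 else 0) fun Z => ?_
  ext x y
  rw [blockPrepare_apply, Matrix.sum_apply, Matrix.sum_apply, Fintype.sum_prod_type]
  simp only [Matrix.sum_apply, Matrix.smul_apply, Matrix.mul_apply, Matrix.conjTranspose_apply,
    Matrix.of_apply, apply_ite star, star_zero, ite_mul, mul_ite, zero_mul, mul_zero, star_mul',
    Finset.sum_mul, Finset.mul_sum, smul_eq_mul]
  rw [Finset.sum_comm]
  symm
  calc _ = ∑ k, ∑ h, ∑ b, ∑ a, (if π b = k then if π a = k then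
        (r k * F a x h * Z a b * (star (r k : ℂ) * star (F b y h))) else 0 else 0) := by
        refine Finset.sum_congr rfl fun k _ => Finset.sum_congr rfl fun h _ =>
          Finset.sum_congr rfl fun b _ => ?_
        by_cases hb : π b = k <;> simp [hb]
    _ = ∑ b, ∑ a, ∑ h, ∑ k, (if π b = k then if π a = k then
        (r k * F a x h * Z a b * (star (r k : ℂ) * star (F b y h))) else 0 else 0) := by
        rw [Finset.sum_comm]
        rw [Finset.sum_congr rfl fun h _ => Finset.sum_comm]
        rw [Finset.sum_comm]
        refine Finset.sum_congr rfl fun b _ => ?_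
        rw [Finset.sum_congr rfl fun h _ => Finset.sum_comm]
        rw [Finset.sum_comm]
    _ = _ := by
        refine Finset.sum_congr rfl fun b _ => Finset.sum_congr rfl fun a _ =>
          Finset.sum_congr rfl fun h _ => ?_
        rw [Finset.sum_ite_eq]
        by_cases hab : π a = π b
        · simp [hab]; ring
        · simp [hab]

lemma blockTrace_trace (π : I → κ) (F : I → Matrix H H ℂ) (X : Matrix H H ℂ) :
    (blockTrace π F X).trace = ((∑ a, F a * (F a)ᴴ) * X).trace := by
  rw [Finset.sum_mul, Matrix.trace_sum, Matrix.trace]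
  refine Finset.sum_congr rfl fun a _ => ?_
  rw [Matrix.diag_apply, blockTrace_apply, if_pos rfl, Matrix.trace_mul_comm, ← mul_assoc]

variable [DecidableEq I] {π : I → κ} {F : I → Matrix H H ℂ} {P : κ → Matrix H H ℂ}

lemma blockPrepare_trace (hF : ∀ a b, (F a)ᴴ * F b = if a = b then P (π a) else 0) {r : κ → ℝ}
    (hr : ∀ k, (r k : ℂ) ^ 2 * (P k).trace = 1) (Z : Matrix I I ℂ) :
    (blockPrepare π F r Z).trace = Z.trace := by
  rw [blockPrepare_apply, Matrix.trace_sum, Matrix.trace]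
  refine Finset.sum_congr rfl fun a _ => ?_
  rw [Matrix.trace_sum, Finset.sum_eq_single a]
  · rw [if_pos rfl, Matrix.trace_smul, Matrix.trace_mul_comm, hF, if_pos rfl, smul_eq_mul,
      mul_right_comm, hr, one_mul, Matrix.diag_apply]
  · intro b _ hb
    rw [Matrix.trace_smul, Matrix.trace_mul_comm, hF, if_neg hb, Matrix.trace_zero, smul_zero]
  · simp

/-- Since `ρ` acts on the `F a` by scalars, `Tr ((F a)ᴴ ρ F b)` is `R a b` times the multiplicity,
and the weight `r ^ 2` divides the multiplicity out. Nothing is lost by dropping the off-diagonal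
blocks because `R` has none. -/
lemma blockPrepare_blockTrace (hF : ∀ a b, (F a)ᴴ * F b = if a = b then P (π a) else 0) {r : κ → ℝ}
    (hr : ∀ k, (r k : ℂ) ^ 2 * (P k).trace = 1) {ρ : Matrix H H ℂ} {R : I → I → ℂ}
    (hR : ∀ a b, R a b ≠ 0 → π a = π b) (hρ : ∀ b, ρ * F b = ∑ a, R a b • F a) :
    blockPrepare π F r (blockTrace π F ρ) = ρ * ∑ a, F a * (F a)ᴴ := by
  have h1 : ∀ a b, ((F a)ᴴ * ρ * F b).trace = R a b * (P (π a)).trace := by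
    intro a b
    rw [mul_assoc, hρ, Finset.mul_sum, Matrix.trace_sum, Finset.sum_eq_single a]
    · rw [Matrix.mul_smul, hF, if_pos rfl, Matrix.trace_smul, smul_eq_mul]
    · intro c _ hc
      rw [Matrix.mul_smul, hF, if_neg (Ne.symm hc), smul_zero, Matrix.trace_zero]
    · simp
  rw [blockPrepare_apply, Finset.sum_comm, Finset.mul_sum]
  refine Finset.sum_congr rfl fun b _ => ?_
  rw [← mul_assoc, hρ, Finset.sum_mul]
  refine Finset.sum_congr rfl fun a _ => ?_
  rw [Matrix.smul_mul]
  congr 1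
  rw [blockTrace_apply, h1]
  by_cases h : π a = π b
  · rw [if_pos h, if_pos h, mul_left_comm, hr, mul_one]
  · rw [if_neg h]
    by_contra hne
    exact h (hR a b (Ne.symm hne))

/-- Conjugation `X ↦ W X Wᴴ` as a linear map. -/
def conjBy {H M : Type*} [Fintype H] (W : Matrix M H ℂ) : Matrix H H ℂ →ₗ[ℂ] Matrix M M ℂ where
  toFun X := W * X * Wᴴ
  map_add' X Y := by rw [Matrix.mul_add, Matrix.add_mul]
  map_smul' c X := by simp

lemma conjBy_apply {H M : Type*} [Fintype H] (W : Matrix M H ℂ) (X : Matrix H H ℂ) :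
    conjBy W X = W * X * Wᴴ := rfl

lemma conjBy_cp {H M : Type*} [Fintype H] [Fintype M] (W : Matrix M H ℂ) :
    IsCompletelyPositive (conjBy W) :=
  IsCompletelyPositive.of_kraus (fun _ : Unit => W) fun X => by simp [conjBy_apply]

lemma exists_isometry_of_card_le {I M : Type*} [Fintype I] [Fintype M] [DecidableEq I]
    [DecidableEq M] (h : Fintype.card I ≤ Fintype.card M) : ∃ W : Matrix M I ℂ, Wᴴ * W = 1 := by
  obtain ⟨f⟩ := Function.Embedding.nonempty_of_card_le h
  refine ⟨Matrix.of fun m a => if f a = m then 1 else 0, ?_⟩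
  ext a b
  rw [Matrix.mul_apply, Matrix.one_apply]
  simp [apply_ite star, f.injective.eq_iff, eq_comm]

/-- Visible compression of the operators that act blockwise on the partial isometries `F a`: the
multiplicity of each block is traced out, and restored by the decoder in the maximally mixed
state. -/
theorem exists_compression [Fintype κ] {M : Type*} [Fintype M] [DecidableEq M] [DecidableEq H]
    (hF : ∀ a b, (F a)ᴴ * F b = if a = b then P (π a) else 0)
    (hFP : ∀ a, F a * P (π a) = F a) (hP : ∀ k, 0 < (P k).trace)
    (hcard : Fintype.card I ≤ Fintype.card M) (h₀ : H) (m₀ : M) :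
    ∃ (E : Matrix H H ℂ →ₗ[ℂ] Matrix M M ℂ) (D : Matrix M M ℂ →ₗ[ℂ] Matrix H H ℂ),
      IsChannel E ∧ IsChannel D ∧
      (∃ ρ₀ : Matrix M M ℂ, IsState ρ₀ ∧ ∀ Q : Matrix H H ℂ, Qᴴ = Q → Q * Q = Q →
        (∀ a, Q * F a = F a) → ∀ X, E X = E (Q * X * Q) + ((1 - Q) * X).trace • ρ₀) ∧
      ∀ (ρ : Matrix H H ℂ) (R : I → I → ℂ), ρ.PosSemidef → (∀ a b, R a b ≠ 0 → π a = π b) →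
        (∀ b, ρ * F b = ∑ a, R a b • F a) →
        traceNorm (ρ - D (E ρ)) / 2 ≤ ((1 - ∑ a, F a * (F a)ᴴ) * ρ).trace.re := by
  obtain ⟨W, hW⟩ := exists_isometry_of_card_le hcard
  have hT := sum_mul_conjTranspose_isHermitian F
  have hTT := sum_mul_conjTranspose_mul_self hF hFP
  have hTF := sum_mul_conjTranspose_mul hF hFP
  have hE0 := blockTrace_trace π F
  set T := ∑ a, F a * (F a)ᴴ with hTdef
  have hQ : (1 - T)ᴴ = 1 - T := by simp [hT]
  have hQQ : (1 - T) * (1 - T) = 1 - T := by simp [mul_sub, sub_mul, hTT]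
  have hV : (1 - W * Wᴴ)ᴴ = 1 - W * Wᴴ := by simp
  have hVV : (1 - W * Wᴴ) * (1 - W * Wᴴ) = 1 - W * Wᴴ := by
    have : W * Wᴴ * (W * Wᴴ) = W * Wᴴ := by
      rw [Matrix.mul_assoc, ← Matrix.mul_assoc Wᴴ, hW, Matrix.one_mul]
    simp [mul_sub, sub_mul, this]
  have hVW : (1 - W * Wᴴ) * W = 0 := by
    rw [Matrix.sub_mul, Matrix.mul_assoc, hW]; simp
  -- `r ^ 2` is the inverse multiplicity, the weight of the maximally mixed state; this is where
  -- `hP` enters.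
  obtain ⟨r, hr⟩ : ∃ r : κ → ℝ, ∀ k, (r k : ℂ) ^ 2 * (P k).trace = 1 := by
    refine ⟨fun k => (√ (P k).trace.re)⁻¹, fun k => ?_⟩
    obtain ⟨h1, h2⟩ := Complex.lt_def.1 (hP k)
    have h3 : (P k).trace = ((P k).trace.re : ℂ) := Complex.ext rfl (by simpa using h2.symm)
    have h1' : 0 < (P k).trace.re := by simpa using h1
    rw [h3, ← Complex.ofReal_pow, ← Complex.ofReal_mul, inv_pow,
      Real.sq_sqrt h1'.le, inv_mul_cancel₀ h1'.ne', Complex.ofReal_one]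
  -- The measure-and-prepare terms make both maps trace preserving: they handle the complement of
  -- the kept sectors and the complement of the range of the embedding `W`.
  let E := conjBy W ∘ₗ blockTrace π F + measurePrepare (1 - T) (basisState m₀)
  let D := blockPrepare π F r ∘ₗ conjBy Wᴴ + measurePrepare (1 - W * Wᴴ) (basisState h₀)
  have hEcp : IsCompletelyPositive E := ((conjBy_cp W).comp (blockTrace_cp π F)).add
    (measurePrepare_basisState_cp hQ hQQ m₀)
  have hDcp : IsCompletelyPositive D := ((blockPrepare_cp π F r).comp (conjBy_cp Wᴴ)).add
    (measurePrepare_basisState_cp hV hVV h₀)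
  have hEX : ∀ X, E X = W * blockTrace π F X * Wᴴ + ((1 - T) * X).trace • basisState m₀ :=
    fun X => rfl
  have hDX : ∀ X, D X = blockPrepare π F r (Wᴴ * X * W)
      + ((1 - W * Wᴴ) * X).trace • basisState h₀ := fun X => by
    simp [D, conjBy_apply, measurePrepare_apply]
  have hEtr : ∀ X, (E X).trace = X.trace := by
    intro X
    rw [hEX, Matrix.trace_add, Matrix.trace_smul, (basisState_isState m₀).2,
      Matrix.trace_mul_comm, ← Matrix.mul_assoc, hW, Matrix.one_mul, hE0, smul_eq_mul, mul_one,
      ← Matrix.trace_add, ← add_mul, add_sub_cancel, one_mul]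
  have hDtr : ∀ X, (D X).trace = X.trace := by
    intro X
    rw [hDX, Matrix.trace_add, Matrix.trace_smul, (basisState_isState h₀).2,
      blockPrepare_trace hF hr, Matrix.trace_mul_comm, ← Matrix.mul_assoc, smul_eq_mul, mul_one,
      ← Matrix.trace_add, ← add_mul, add_sub_cancel, one_mul]
  refine ⟨E, D, ⟨hEtr, hEcp⟩, ⟨hDtr, hDcp⟩, ⟨basisState m₀, basisState_isState m₀, ?_⟩, ?_⟩
  -- `Q` may be any projector above `T`. The part of the input between `T` and `Q` is already
  -- replaced by the same state as the part outside `Q`.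
  · intro Q hQh hQ2 hQF X
    have h1 : blockTrace π F (Q * X * Q) = blockTrace π F X := by
      ext a b
      rw [blockTrace_apply, blockTrace_apply]
      have h2 : (F a)ᴴ * Q = (F a)ᴴ := by
        have := congrArg Matrix.conjTranspose (hQF a)
        rwa [Matrix.conjTranspose_mul, hQh] at this
      have h3 : (F a)ᴴ * (Q * X * Q) * F b = ((F a)ᴴ * Q) * X * (Q * F b) := by
        simp only [mul_assoc]
      rw [h3, h2, hQF]
    have hQT : Q * T = T := by
      rw [hTdef, Finset.mul_sum]
      exact Finset.sum_congr rfl fun a _ => by rw [← mul_assoc, hQF]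
    have h3 : ((1 - T) * (Q * X * Q)).trace + ((1 - Q) * X).trace = ((1 - T) * X).trace := by
      have : ((1 - T) * (Q * X * Q)).trace = ((Q - T) * X).trace := by
        rw [← mul_assoc, Matrix.trace_mul_comm, ← mul_assoc, ← mul_assoc, mul_sub, mul_one, hQT,
          sub_mul, hQ2]
        congr 2
        rw [show T * Q = T from ?_]
        have := congrArg Matrix.conjTranspose hQT
        rwa [Matrix.conjTranspose_mul, hQh, hT] at this
      rw [this, ← Matrix.trace_add, ← add_mul]
      congr 2
      abel
    rw [hEX, hEX, h1, add_assoc, ← add_smul, h3]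
  · intro ρ R hρ hR hρF
    have hDE : D (E ρ) = ρ * T + ((1 - T) * ρ).trace • D (basisState m₀) := by
      have h1 : (1 - W * Wᴴ) * (W * blockTrace π F ρ * Wᴴ) = 0 := by
        rw [Matrix.mul_assoc, ← Matrix.mul_assoc, hVW, Matrix.zero_mul]
      have h2 : Wᴴ * (W * blockTrace π F ρ * Wᴴ) * W = blockTrace π F ρ := by
        rw [Matrix.mul_assoc W, ← Matrix.mul_assoc, hW, Matrix.one_mul, Matrix.mul_assoc, hW,
          Matrix.mul_one]
      rw [hEX, map_add, map_smul, hDX (W * _ * Wᴴ), h1, h2, blockPrepare_blockTrace hF hr hR hρF,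
        ← hTdef]
      simp
    have hTρT : T * (ρ * T) = ρ * T := by
      have h1 : ρ * T = ∑ b, ∑ a, R a b • (F a * (F b)ᴴ) := by
        rw [hTdef, Finset.mul_sum]
        refine Finset.sum_congr rfl fun b _ => ?_
        rw [← mul_assoc, hρF, Finset.sum_mul]
        exact Finset.sum_congr rfl fun a _ => smul_mul_assoc _ _ _
      rw [h1, Finset.mul_sum]
      refine Finset.sum_congr rfl fun b _ => ?_
      rw [Finset.mul_sum]
      refine Finset.sum_congr rfl fun a _ => ?_
      rw [mul_smul_comm, ← mul_assoc, hTF]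
    -- The adjoint of `T ρ T = ρ T` is `T ρ T = T ρ`.
    have hcomm : T * ρ = ρ * T := by
      have := congrArg Matrix.conjTranspose hTρT
      rw [Matrix.conjTranspose_mul, Matrix.conjTranspose_mul, hT, hρ.1.eq, mul_assoc] at this
      rw [← this, hTρT]
    have hpsd : (ρ * (1 - T)).PosSemidef := by
      have := hρ.mul_mul_conjTranspose_same (1 - T)
      rw [hQ] at this
      have h2 : (1 - T) * ρ = ρ * (1 - T) := by rw [sub_mul, mul_sub, hcomm]; simp
      rwa [h2, mul_assoc, hQQ] at this
    have htr : ((1 - T) * ρ).trace = (ρ * (1 - T)).trace := Matrix.trace_mul_comm _ _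
    have hpos : (0 : ℂ) ≤ (ρ * (1 - T)).trace := hpsd.trace_nonneg
    have hsub : ρ - D (E ρ) = ρ * (1 - T) - (ρ * (1 - T)).trace • D (basisState m₀) := by
      rw [hDE, htr, mul_sub, mul_one, sub_sub]
    -- Both terms have trace `Tr (ρ (1 - T))`, and this 2 cancels the 1/2 of the trace distance.
    have hle := traceNorm_sub_le hpsd
      ((hDcp.map_posSemidef (basisState_isState m₀).1).smul hpos)
    rw [hsub, htr]
    rw [Matrix.trace_smul, hDtr, (basisState_isState m₀).2, smul_eq_mul, mul_one] at hle
    linarith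

end Compression

/-! ### Collective spin operators and their commutation relations. -/

section SpinAlgebra

variable {N : ℕ}

/-- The tensor product `A₁ ⊗ ⋯ ⊗ A_N` of single-qubit operators. -/
def tensorProd (A : Fin N → Matrix (Fin 2) (Fin 2) ℂ) : Op N :=
  fun x y => ∏ i, A i (x i) (y i)

lemma tensorProd_mul (A B : Fin N → Matrix (Fin 2) (Fin 2) ℂ) :
    tensorProd A * tensorProd B = tensorProd fun i => A i * B i := by
  ext x y
  simp only [Matrix.mul_apply, tensorProd, ← Finset.prod_mul_distrib]
  rw [Finset.prod_univ_sum, Fintype.piFinset_univ]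

lemma tensorPower_eq_tensorProd (A : Matrix (Fin 2) (Fin 2) ℂ) :
    tensorPower N A = tensorProd fun _ => A := rfl

lemma onSite_eq_tensorProd (i : Fin N) (A : Matrix (Fin 2) (Fin 2) ℂ) :
    onSite i A = tensorProd (Function.update (fun _ => 1) i A) := by
  ext x y
  rw [onSite, tensorProd, ← Finset.mul_prod_erase _ _ (Finset.mem_univ i),
    Function.update_self]
  have h : ∀ k ∈ Finset.univ.erase i, Function.update (fun _ => (1 : Matrix (Fin 2) (Fin 2) ℂ)) i A k
      (x k) (y k) = if x k = y k then 1 else 0 := by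
    intro k hk
    rw [Function.update_of_ne (Finset.ne_of_mem_erase hk), Matrix.one_apply]
  rw [Finset.prod_congr rfl h, Finset.prod_ite_zero]
  simp

lemma onSite_mul_same (i : Fin N) (A B : Matrix (Fin 2) (Fin 2) ℂ) :
    onSite i A * onSite i B = onSite i (A * B) := by
  simp only [onSite_eq_tensorProd, tensorProd_mul]
  congr 1
  ext1 k
  by_cases h : k = i
  · subst h; simp
  · simp [h]

lemma onSite_mul_comm {i j : Fin N} (h : i ≠ j) (A B : Matrix (Fin 2) (Fin 2) ℂ) :
    onSite i A * onSite j B = onSite j B * onSite i A := by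
  simp only [onSite_eq_tensorProd, tensorProd_mul]
  congr 1
  ext1 k
  by_cases h1 : k = i
  · subst h1; simp [h]
  · simp [h1]

lemma tensorPower_mul_onSite {U A B : Matrix (Fin 2) (Fin 2) ℂ} (h : U * A = B * U) (i : Fin N) :
    tensorPower N U * onSite i A = onSite i B * tensorPower N U := by
  simp only [onSite_eq_tensorProd, tensorPower_eq_tensorProd, tensorProd_mul]
  congr 1
  ext1 k
  by_cases h1 : k = i
  · subst h1; simp [h]
  · simp [h1]

lemma tensorPower_mul (A B : Matrix (Fin 2) (Fin 2) ℂ) :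
    tensorPower N A * tensorPower N B = tensorPower N (A * B) := by
  simp only [tensorPower_eq_tensorProd, tensorProd_mul]

lemma tensorPower_conjTranspose (A : Matrix (Fin 2) (Fin 2) ℂ) :
    (tensorPower N A)ᴴ = tensorPower N Aᴴ := by
  ext x y
  simp [tensorPower]

lemma tensorPower_one : tensorPower N (1 : Matrix (Fin 2) (Fin 2) ℂ) = 1 := by
  ext x y
  simp only [tensorPower, Matrix.one_apply, Finset.prod_ite_zero]
  simp [funext_iff]

lemma tensorPower_trace (A : Matrix (Fin 2) (Fin 2) ℂ) :
    (tensorPower N A).trace = A.trace ^ N := by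
  have h := Finset.prod_univ_sum (fun _ : Fin N => (Finset.univ : Finset (Fin 2))) fun _ j => A j j
  rw [Fintype.piFinset_univ, Finset.prod_const, Finset.card_univ, Fintype.card_fin] at h
  exact h.symm

/-- The number of qubits in the state `1` of a computational-basis label. -/
def hammingWeight (x : Qubits N) : ℕ := (Finset.univ.filter fun i => x i = 1).card

lemma hammingWeight_le (x : Qubits N) : hammingWeight x ≤ N :=
  (Finset.card_le_univ _).trans_eq (Fintype.card_fin N)

lemma tensorPower_diagonal (a b : ℂ) :
    tensorPower N (Matrix.diagonal ![a, b]) =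
      Matrix.diagonal fun x => a ^ (N - hammingWeight x) * b ^ hammingWeight x := by
  ext x y
  rw [Matrix.diagonal_apply]
  split_ifs with h
  · subst h
    have h1 : ∀ i, Matrix.diagonal ![a, b] (x i) (x i) = if x i = 1 then b else a := by
      intro i
      rcases Fin.exists_fin_two.1 ⟨x i, rfl⟩ with h | h <;> simp [h]
    have h2 : (Finset.univ.filter fun i => ¬ x i = 1).card = N - hammingWeight x := by
      have := Finset.card_filter_add_card_filter_not (s := (Finset.univ : Finset (Fin N)))
        (fun i => x i = 1)
      simp only [Finset.card_univ, Fintype.card_fin] at this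
      unfold hammingWeight
      omega
    rw [tensorPower, Finset.prod_congr rfl fun i _ => h1 i, Finset.prod_ite, Finset.prod_const,
      Finset.prod_const, h2, mul_comm]
    rfl
  · obtain ⟨i, hi⟩ := Function.ne_iff.1 h
    exact Finset.prod_eq_zero (Finset.mem_univ i) (Matrix.diagonal_apply_ne _ hi)

/-- The collective operator `∑ᵢ A⁽ⁱ⁾`. -/
def collective (N : ℕ) : Matrix (Fin 2) (Fin 2) ℂ →ₗ[ℂ] Op N where
  toFun A := ∑ i, onSite i A
  map_add' A B := by
    rw [← Finset.sum_add_distrib]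
    refine Finset.sum_congr rfl fun i _ => ?_
    ext x y
    by_cases h : ∀ k, k ≠ i → x k = y k
    · simp only [onSite, Matrix.add_apply, if_pos h]
    · simp only [onSite, Matrix.add_apply, if_neg h, add_zero]
  map_smul' c A := by
    rw [RingHom.id_apply, Finset.smul_sum]
    refine Finset.sum_congr rfl fun i _ => ?_
    ext x y
    by_cases h : ∀ k, k ≠ i → x k = y k
    · simp only [onSite, Matrix.smul_apply, if_pos h]
    · simp only [onSite, Matrix.smul_apply, if_neg h, smul_zero]

lemma collective_apply (A : Matrix (Fin 2) (Fin 2) ℂ) : collective N A = ∑ i, onSite i A := rfl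

lemma totalSpin_eq_collective (a : Fin 3) :
    totalSpin N a = collective N ((1 / 2 : ℂ) • pauli a) := rfl

/-- Operators on different sites commute, so only the diagonal terms of the double sum survive. -/
lemma collective_commutator (A B : Matrix (Fin 2) (Fin 2) ℂ) :
    collective N A * collective N B - collective N B * collective N A =
      collective N (A * B - B * A) := by
  rw [map_sub]
  simp only [collective_apply, Finset.sum_mul_sum]
  rw [Finset.sum_comm (f := fun i j => onSite i B * onSite j A), ← Finset.sum_sub_distrib,
    ← Finset.sum_sub_distrib]
  refine Finset.sum_congr rfl fun i _ => ?_
  rw [← Finset.sum_sub_distrib, Finset.sum_eq_single i]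
  · rw [onSite_mul_same, onSite_mul_same]
  · intro j _ hj
    rw [onSite_mul_comm (Ne.symm hj), sub_self]
  · simp

lemma collective_conjTranspose (A : Matrix (Fin 2) (Fin 2) ℂ) :
    (collective N A)ᴴ = collective N Aᴴ := by
  rw [collective_apply, collective_apply, Matrix.conjTranspose_sum]
  refine Finset.sum_congr rfl fun i _ => ?_
  ext x y
  simp [onSite, apply_ite star, eq_comm]

lemma tensorPower_mul_collective {U A B : Matrix (Fin 2) (Fin 2) ℂ} (h : U * A = B * U) :
    tensorPower N U * collective N A = collective N B * tensorPower N U := by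
  rw [collective_apply, collective_apply, Finset.mul_sum, Finset.sum_mul]
  exact Finset.sum_congr rfl fun i _ => tensorPower_mul_onSite h i

/-- The raising operator `J₊ = J_x + i J_y`. -/
def raising (N : ℕ) : Op N := collective N !![0, 1; 0, 0]

/-- The lowering operator `J₋ = J_x - i J_y`. -/
def lowering (N : ℕ) : Op N := collective N !![0, 0; 1, 0]

lemma raising_conjTranspose : (raising N)ᴴ = lowering N := by
  rw [raising, lowering, collective_conjTranspose]
  congr 1
  ext i j
  fin_cases i <;> fin_cases j <;> simp

lemma lowering_conjTranspose : (lowering N)ᴴ = raising N := by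
  rw [← raising_conjTranspose, Matrix.conjTranspose_conjTranspose]

lemma totalSpin_two_mul_raising :
    totalSpin N 2 * raising N = raising N * totalSpin N 2 + raising N := by
  rw [← sub_eq_iff_eq_add', totalSpin_eq_collective, raising, collective_commutator]
  congr 1
  ext i j
  fin_cases i <;> fin_cases j <;> simp [pauli]
  norm_num

lemma totalSpin_two_mul_lowering :
    totalSpin N 2 * lowering N = lowering N * totalSpin N 2 - lowering N := by
  rw [sub_eq_add_neg, ← sub_eq_iff_eq_add', totalSpin_eq_collective, lowering,
    collective_commutator, ← map_neg]
  congr 1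
  ext i j
  fin_cases i <;> fin_cases j <;> simp [pauli]
  norm_num

lemma raising_mul_lowering :
    raising N * lowering N = lowering N * raising N + (2 : ℂ) • totalSpin N 2 := by
  rw [← sub_eq_iff_eq_add', totalSpin_eq_collective, raising, lowering, collective_commutator,
    ← map_smul]
  congr 1
  ext i j
  fin_cases i <;> fin_cases j <;> simp [pauli]

lemma totalSpin_zero_eq : totalSpin N 0 = (1 / 2 : ℂ) • (raising N + lowering N) := by
  rw [totalSpin_eq_collective, raising, lowering, ← map_add, ← map_smul]
  congr 1
  ext i j
  fin_cases i <;> fin_cases j <;> simp [pauli]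

lemma totalSpin_one_eq :
    totalSpin N 1 = (-Complex.I / 2) • (raising N - lowering N) := by
  rw [totalSpin_eq_collective, raising, lowering, ← map_sub, ← map_smul]
  congr 1
  ext i j
  fin_cases i <;> fin_cases j <;> simp [pauli] <;> ring

/-- With `J₊` on the right, the value of `J²` on a highest-weight vector can be read off. -/
lemma totalSpinSq_eq :
    totalSpinSq N = lowering N * raising N + totalSpin N 2 * totalSpin N 2 + totalSpin N 2 := by
  have hI : (-Complex.I / 2) * (-Complex.I / 2) = -(1 / 4 : ℂ) := by
    ring_nf; rw [Complex.I_sq]; ring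
  rw [totalSpinSq, Fin.sum_univ_three, totalSpin_zero_eq, totalSpin_one_eq, smul_mul_smul_comm,
    smul_mul_smul_comm, hI]
  simp only [mul_add, add_mul, mul_sub, sub_mul, raising_mul_lowering]
  module

lemma totalSpin_two_eq_diagonal :
    totalSpin N 2 = Matrix.diagonal fun x => (N : ℂ) / 2 - hammingWeight x := by
  ext x y
  rw [totalSpin, Matrix.sum_apply, Matrix.diagonal_apply]
  have h1 : ∀ i : Fin N, onSite i ((1 / 2 : ℂ) • pauli 2) x y =
      if x = y then (1 / 2 - if x i = 1 then 1 else 0) else 0 := by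
    intro i
    rw [onSite]
    by_cases hxy : x = y
    · subst hxy
      simp only [implies_true, if_true, Matrix.smul_apply, pauli]
      rcases Fin.exists_fin_two.1 ⟨x i, rfl⟩ with h | h
      · simp [h]
      · simp [h]; norm_num
    · rw [if_neg hxy]
      split_ifs with h
      · have : x i ≠ y i := by
          intro hi
          refine hxy (funext fun k => ?_)
          by_cases hk : k = i
          · rw [hk, hi]
          · exact h k hk
        rcases Fin.exists_fin_two.1 ⟨x i, rfl⟩ with h | h <;>
        rcases Fin.exists_fin_two.1 ⟨y i, rfl⟩ with h' | h' <;> simp_all [pauli]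
      · rfl
  rw [Finset.sum_congr rfl fun i _ => h1 i]
  split_ifs with h
  · rw [Finset.sum_sub_distrib]
    simp [hammingWeight, div_eq_mul_inv]
  · simp

lemma totalSpin_two_conjTranspose : (totalSpin N 2)ᴴ = totalSpin N 2 := by
  rw [totalSpin_two_eq_diagonal, Matrix.diagonal_conjTranspose]
  congr 1
  ext x
  simp

end SpinAlgebra

/-! ### Orthogonal projections as matrices. -/

section ProjMatrix

variable {ι : Type*} [Fintype ι] [DecidableEq ι]

/-- The matrix of the orthogonal projection onto a subspace. -/
def projMatrix (K : Submodule ℂ (EuclideanSpace ℂ ι)) : Matrix ι ι ℂ :=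
  Matrix.toEuclideanLin.symm
    (K.starProjection : EuclideanSpace ℂ ι →L[ℂ] EuclideanSpace ℂ ι).toLinearMap

lemma toEuclideanLin_projMatrix (K : Submodule ℂ (EuclideanSpace ℂ ι)) :
    Matrix.toEuclideanLin (projMatrix K) =
      (K.starProjection : EuclideanSpace ℂ ι →L[ℂ] EuclideanSpace ℂ ι).toLinearMap :=
  LinearEquiv.apply_symm_apply _ _

lemma projMatrix_conjTranspose (K : Submodule ℂ (EuclideanSpace ℂ ι)) :
    (projMatrix K)ᴴ = projMatrix K := by
  have h : (projMatrix K).IsHermitian := by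
    rw [← Matrix.isSymmetric_toEuclideanLin_iff, toEuclideanLin_projMatrix]
    exact K.starProjection_isSymmetric
  exact h

lemma projMatrix_mul_eq {K : Submodule ℂ (EuclideanSpace ℂ ι)} {A : Matrix ι ι ℂ}
    (h : ∀ v, Matrix.toEuclideanLin A v ∈ K) : projMatrix K * A = A := by
  apply Matrix.toEuclideanLin.injective
  rw [Matrix.toLpLin_mul_same, toEuclideanLin_projMatrix]
  ext1 v
  exact Submodule.starProjection_eq_self_iff.2 (h v)

lemma toEuclideanLin_projMatrix_mem (K : Submodule ℂ (EuclideanSpace ℂ ι))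
    (v : EuclideanSpace ℂ ι) : Matrix.toEuclideanLin (projMatrix K) v ∈ K := by
  rw [toEuclideanLin_projMatrix]
  exact K.starProjection_apply_mem v

lemma projMatrix_mul_self (K : Submodule ℂ (EuclideanSpace ℂ ι)) :
    projMatrix K * projMatrix K = projMatrix K :=
  projMatrix_mul_eq (toEuclideanLin_projMatrix_mem K)

lemma mul_projMatrix_eq_zero {K : Submodule ℂ (EuclideanSpace ℂ ι)} {A : Matrix ι ι ℂ}
    (h : K ≤ LinearMap.ker (Matrix.toEuclideanLin A)) : A * projMatrix K = 0 := by
  apply Matrix.toEuclideanLin.injective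
  rw [Matrix.toLpLin_mul_same, map_zero]
  ext1 v
  exact h (toEuclideanLin_projMatrix_mem K v)

lemma toEuclideanLin_mem_ker {A B : Matrix ι ι ℂ} (h : A * B = 0) (v : EuclideanSpace ℂ ι) :
    Matrix.toEuclideanLin B v ∈ LinearMap.ker (Matrix.toEuclideanLin A) := by
  rw [LinearMap.mem_ker, ← LinearMap.comp_apply, ← Matrix.toLpLin_mul_same, h, map_zero,
    LinearMap.zero_apply]

end ProjMatrix

/-! ### Highest-weight vectors and the ladders below them. -/

section Ladder

variable {N : ℕ}

/-- The vectors of highest weight `N / 2 - k`. -/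
def highestWeightSpace (N k : ℕ) : Submodule ℂ (EuclideanSpace ℂ (Qubits N)) :=
  LinearMap.ker (Matrix.toEuclideanLin (raising N)) ⊓
    LinearMap.ker (Matrix.toEuclideanLin (totalSpin N 2 - ((N : ℂ) / 2 - k) • 1))

/-- The projector onto the vectors of highest weight `N / 2 - k`. -/
def highestWeightProj (N k : ℕ) : Op N := projMatrix (highestWeightSpace N k)

lemma highestWeightProj_conjTranspose (k : ℕ) :
    (highestWeightProj N k)ᴴ = highestWeightProj N k := projMatrix_conjTranspose _

lemma highestWeightProj_mul_self (k : ℕ) :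
    highestWeightProj N k * highestWeightProj N k = highestWeightProj N k := projMatrix_mul_self _

lemma raising_mul_highestWeightProj (k : ℕ) : raising N * highestWeightProj N k = 0 :=
  mul_projMatrix_eq_zero inf_le_left

lemma highestWeightProj_mul_lowering (k : ℕ) : highestWeightProj N k * lowering N = 0 := by
  have := congrArg Matrix.conjTranspose (raising_mul_highestWeightProj (N := N) k)
  rwa [Matrix.conjTranspose_mul, raising_conjTranspose, highestWeightProj_conjTranspose,
    Matrix.conjTranspose_zero] at this

lemma totalSpin_two_mul_highestWeightProj (k : ℕ) :
    totalSpin N 2 * highestWeightProj N k = ((N : ℂ) / 2 - k) • highestWeightProj N k := by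
  have h : (totalSpin N 2 - ((N : ℂ) / 2 - k) • 1) * highestWeightProj N k = 0 :=
    mul_projMatrix_eq_zero inf_le_right
  rwa [sub_mul, smul_mul_assoc, one_mul, sub_eq_zero] at h

lemma highestWeightProj_mul_eq {k : ℕ} {A : Op N} (h₁ : raising N * A = 0)
    (h₂ : totalSpin N 2 * A = ((N : ℂ) / 2 - k) • A) : highestWeightProj N k * A = A := by
  refine projMatrix_mul_eq fun v => ⟨toEuclideanLin_mem_ker h₁ v, toEuclideanLin_mem_ker ?_ v⟩
  rw [sub_mul, smul_mul_assoc, one_mul, h₂, sub_self]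

lemma highestWeightProj_mul_of_ne {k l : ℕ} (h : k ≠ l) :
    highestWeightProj N k * highestWeightProj N l = 0 := by
  have h1 := congrArg Matrix.conjTranspose (totalSpin_two_mul_highestWeightProj (N := N) k)
  rw [Matrix.conjTranspose_mul, totalSpin_two_conjTranspose, highestWeightProj_conjTranspose,
    Matrix.conjTranspose_smul, highestWeightProj_conjTranspose] at h1
  have h2 := congrArg (highestWeightProj N k * ·) (totalSpin_two_mul_highestWeightProj (N := N) l)
  simp only [← mul_assoc, h1, smul_mul_assoc, mul_smul_comm] at h2
  rw [← sub_eq_zero, ← sub_smul, smul_eq_zero] at h2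
  refine h2.resolve_left ?_
  simp only [star_sub, star_div₀, star_natCast, star_ofNat]
  intro h3
  refine h ?_
  have : (l : ℂ) = k := by linear_combination h3
  exact_mod_cast this.symm

lemma totalSpin_two_mul_lowering_pow (k i : ℕ) :
    totalSpin N 2 * (lowering N ^ i * highestWeightProj N k) =
      ((N : ℂ) / 2 - k - i) • (lowering N ^ i * highestWeightProj N k) := by
  induction i with
  | zero => simpa using totalSpin_two_mul_highestWeightProj k
  | succ i ih =>
    rw [pow_succ', mul_assoc, ← mul_assoc, totalSpin_two_mul_lowering, sub_mul, mul_assoc, ih,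
      mul_smul_comm]
    push_cast
    module

/-- Moving `J₊` to the right picks up `2 J_z` at each rung. With `D = N - 2k` the coefficient is
`∑_{l ≤ i} (D - 2l) = (i + 1)(D - i)`. -/
lemma raising_mul_lowering_pow_succ {k : ℕ} (hk : 2 * k ≤ N) (i : ℕ) :
    raising N * (lowering N ^ (i + 1) * highestWeightProj N k) =
      (((i : ℂ) + 1) * (((N - 2 * k : ℕ) : ℂ) - i)) •
        (lowering N ^ i * highestWeightProj N k) := by
  have hD : ((N - 2 * k : ℕ) : ℂ) = N - 2 * k := by push_cast [hk]; ring
  rw [hD]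
  induction i with
  | zero =>
    rw [zero_add, pow_one, ← mul_assoc, raising_mul_lowering, add_mul, mul_assoc,
      raising_mul_highestWeightProj, smul_mul_assoc, totalSpin_two_mul_highestWeightProj, pow_zero]
    simp only [mul_zero, one_mul]
    module
  | succ i ih =>
    rw [pow_succ' _ (i + 1), mul_assoc, ← mul_assoc, raising_mul_lowering, add_mul, mul_assoc, ih,
      mul_smul_comm, ← mul_assoc, ← pow_succ', smul_mul_assoc, totalSpin_two_mul_lowering_pow]
    push_cast
    module

/-- The squared norm of `J₋ⁱ v` for a unit vector `v` of highest weight `D / 2`. -/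
def ladderNorm (D i : ℕ) : ℕ := i.factorial * D.descFactorial i

lemma ladderNorm_pos {D i : ℕ} (h : i ≤ D) : 0 < ladderNorm D i :=
  Nat.mul_pos i.factorial_pos (Nat.descFactorial_pos.2 h)

lemma ladderNorm_succ (D i : ℕ) :
    (ladderNorm D (i + 1) : ℂ) = ((i : ℂ) + 1) * ((D : ℂ) - i) * ladderNorm D i := by
  rw [ladderNorm, ladderNorm, Nat.factorial_succ, Nat.descFactorial_succ]
  rcases le_or_gt i D with h | h
  · push_cast [h]; ring
  · simp [Nat.descFactorial_eq_zero_iff_lt.2 h]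

lemma raising_pow_mul_lowering_pow {k : ℕ} (hk : 2 * k ≤ N) (i : ℕ) :
    raising N ^ i * (lowering N ^ i * highestWeightProj N k) =
      (ladderNorm (N - 2 * k) i : ℂ) • highestWeightProj N k := by
  induction i with
  | zero => simp [ladderNorm]
  | succ i ih =>
    rw [pow_succ, mul_assoc, raising_mul_lowering_pow_succ hk, mul_smul_comm, ih, smul_smul,
      ladderNorm_succ]

lemma raising_pow_mul_lowering_pow_add {k : ℕ} (hk : 2 * k ≤ N) (i r : ℕ) :
    ∃ c : ℂ, raising N ^ i * (lowering N ^ (i + r) * highestWeightProj N k) =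
      c • (lowering N ^ r * highestWeightProj N k) := by
  induction i with
  | zero => exact ⟨1, by simp⟩
  | succ i ih =>
    obtain ⟨c, hc⟩ := ih
    refine ⟨(((i + r : ℕ) : ℂ) + 1) * (((N - 2 * k : ℕ) : ℂ) - (i + r : ℕ)) * c, ?_⟩
    rw [pow_succ, mul_assoc, add_right_comm, raising_mul_lowering_pow_succ hk, mul_smul_comm, hc,
      smul_smul]

lemma lowering_pow_mul_conjTranspose (k i : ℕ) :
    (lowering N ^ i * highestWeightProj N k)ᴴ = highestWeightProj N k * raising N ^ i := by
  rw [Matrix.conjTranspose_mul, Matrix.conjTranspose_pow, lowering_conjTranspose,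
    highestWeightProj_conjTranspose]

/-- After `i` raisings at least one `J₋` is left over, and it is killed by the highest-weight
projector on its left. -/
lemma lowering_pow_orthogonal {k l i j : ℕ} (hl : 2 * l ≤ N) (hij : i < j) :
    (lowering N ^ i * highestWeightProj N k)ᴴ * (lowering N ^ j * highestWeightProj N l) = 0 := by
  obtain ⟨r, rfl⟩ := Nat.exists_eq_add_of_lt hij
  obtain ⟨c, hc⟩ := raising_pow_mul_lowering_pow_add hl i (r + 1)
  rw [lowering_pow_mul_conjTranspose, mul_assoc, add_assoc, hc, mul_smul_comm, pow_succ', mul_assoc,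
    ← mul_assoc, highestWeightProj_mul_lowering, zero_mul, smul_zero]

/-- The squared norm is a multiple of `ladderNorm`, whose descending factorial vanishes: the ladder
ends after `2j + 1` rungs. -/
lemma lowering_pow_mul_eq_zero {k i : ℕ} (hk : 2 * k ≤ N) (hi : N - 2 * k < i) :
    lowering N ^ i * highestWeightProj N k = 0 := by
  rw [← Matrix.conjTranspose_mul_self_eq_zero, lowering_pow_mul_conjTranspose, mul_assoc,
    raising_pow_mul_lowering_pow hk, ladderNorm, Nat.descFactorial_eq_zero_iff_lt.2 hi]
  simp

/-- The partial isometry from the vectors of highest weight `N / 2 - k` to the vectors of weight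
`N / 2 - k - i` in the same irreducible components. -/
def ladder (N k i : ℕ) : Op N :=
  ((√ (ladderNorm (N - 2 * k) i : ℝ))⁻¹ : ℂ) • (lowering N ^ i * highestWeightProj N k)

lemma ladder_zero (k : ℕ) : ladder N k 0 = highestWeightProj N k := by
  simp [ladder, ladderNorm]

lemma ladder_mul_highestWeightProj (k i : ℕ) :
    ladder N k i * highestWeightProj N k = ladder N k i := by
  rw [ladder, smul_mul_assoc, mul_assoc, highestWeightProj_mul_self]

lemma lowering_pow_eq_ladder {k i : ℕ} (hi : i ≤ N - 2 * k) :
    lowering N ^ i * highestWeightProj N k =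
      (√ (ladderNorm (N - 2 * k) i : ℝ) : ℂ) • ladder N k i := by
  have : (√ (ladderNorm (N - 2 * k) i : ℝ) : ℂ) ≠ 0 := by
    rw [Ne, Complex.ofReal_eq_zero, Real.sqrt_eq_zero (Nat.cast_nonneg _), Nat.cast_eq_zero]
    exact (ladderNorm_pos hi).ne'
  rw [ladder, smul_smul, mul_inv_cancel₀ this, one_smul]

/-- This is the orthogonality hypothesis of `exists_compression`. Different rungs are orthogonal by
`lowering_pow_orthogonal`; on equal rungs the product reduces to that of the two highest-weight
projectors. -/
lemma ladder_conjTranspose_mul {k l i j : ℕ} (hk : 2 * k ≤ N) (hl : 2 * l ≤ N)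
    (hi : i ≤ N - 2 * k) :
    (ladder N k i)ᴴ * ladder N l j = if k = l ∧ i = j then highestWeightProj N k else 0 := by
  rw [ladder, ladder, Matrix.conjTranspose_smul, smul_mul_smul_comm]
  rcases lt_trichotomy i j with hij | hij | hij
  · rw [lowering_pow_orthogonal hl hij, smul_zero, if_neg fun h => hij.ne h.2]
  · subst hij
    rw [lowering_pow_mul_conjTranspose, mul_assoc, raising_pow_mul_lowering_pow hl, mul_smul_comm]
    by_cases hkl : k = l
    · subst hkl
      rw [highestWeightProj_mul_self, smul_smul, if_pos ⟨rfl, rfl⟩]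
      have h1 : (0 : ℝ) < ladderNorm (N - 2 * k) i := by exact_mod_cast ladderNorm_pos hi
      have h2 : star ((√ (ladderNorm (N - 2 * k) i : ℝ))⁻¹ : ℂ) *
          ((√ (ladderNorm (N - 2 * k) i : ℝ))⁻¹ : ℂ) * (ladderNorm (N - 2 * k) i : ℂ) = 1 := by
        rw [← Complex.ofReal_inv, Complex.star_def, Complex.conj_ofReal, ← Complex.ofReal_natCast,
          ← Complex.ofReal_mul, ← Complex.ofReal_mul, ← mul_inv, Real.mul_self_sqrt h1.le,
          inv_mul_cancel₀ h1.ne', Complex.ofReal_one]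
      rw [h2, one_smul]
    · rw [highestWeightProj_mul_of_ne hkl, smul_zero, smul_zero, if_neg fun h => hkl h.1]
  · have := congrArg Matrix.conjTranspose (lowering_pow_orthogonal (k := l) hk hij)
    rw [Matrix.conjTranspose_mul, Matrix.conjTranspose_conjTranspose,
      Matrix.conjTranspose_zero] at this
    rw [this, smul_zero, if_neg fun h => hij.ne' h.2]

lemma totalSpin_two_mul_ladder (k i : ℕ) :
    totalSpin N 2 * ladder N k i = ((N : ℂ) / 2 - k - i) • ladder N k i := by
  rw [ladder, mul_smul_comm, totalSpin_two_mul_lowering_pow, smul_comm]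

lemma totalSpinSq_commute_lowering : Commute (totalSpinSq N) (lowering N) := by
  have h1 : raising N * lowering N = lowering N * raising N + (2 : ℂ) • totalSpin N 2 :=
    raising_mul_lowering
  have h2 : totalSpin N 2 * lowering N = lowering N * totalSpin N 2 - lowering N :=
    totalSpin_two_mul_lowering
  rw [Commute, SemiconjBy, totalSpinSq_eq]
  have h3 : lowering N * raising N * lowering N = lowering N * (lowering N * raising N) +
      (2 : ℂ) • (lowering N * totalSpin N 2) := by
    rw [mul_assoc, h1, mul_add, mul_smul_comm]
  have h4 : totalSpin N 2 * totalSpin N 2 * lowering N =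
      lowering N * (totalSpin N 2 * totalSpin N 2) - (2 : ℂ) • (lowering N * totalSpin N 2)
        + lowering N := by
    rw [mul_assoc, h2, mul_sub, ← mul_assoc, h2, sub_mul, mul_assoc]
    module
  rw [add_mul, add_mul, h3, h4, h2, mul_add, mul_add]
  module

lemma totalSpinSq_mul_ladder (k i : ℕ) :
    totalSpinSq N * ladder N k i =
      (((N : ℂ) / 2 - k) * ((N : ℂ) / 2 - k + 1)) • ladder N k i := by
  have h : totalSpinSq N * highestWeightProj N k =
      (((N : ℂ) / 2 - k) * ((N : ℂ) / 2 - k + 1)) • highestWeightProj N k := by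
    rw [totalSpinSq_eq, add_mul, add_mul, mul_assoc, raising_mul_highestWeightProj, mul_assoc,
      totalSpin_two_mul_highestWeightProj, mul_smul_comm, totalSpin_two_mul_highestWeightProj,
      mul_zero]
    module
  rw [ladder, mul_smul_comm, ← mul_assoc, (totalSpinSq_commute_lowering.pow_right i).eq, mul_assoc,
    h, mul_smul_comm, smul_comm]

end Ladder

/-! ### The algebra of the collective spin acts on ladders by scalars. -/

section SpinSubalgebra

variable {N : ℕ}

/-- The algebra generated by the components of the total angular momentum. -/
def spinAlgebra (N : ℕ) : Subalgebra ℂ (Op N) :=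
  Algebra.adjoin ℂ {raising N, lowering N, totalSpin N 2}

lemma raising_mem_spinAlgebra : raising N ∈ spinAlgebra N :=
  Algebra.subset_adjoin (by simp)

lemma lowering_mem_spinAlgebra : lowering N ∈ spinAlgebra N :=
  Algebra.subset_adjoin (by simp)

lemma totalSpin_mem_spinAlgebra (a : Fin 3) : totalSpin N a ∈ spinAlgebra N := by
  fin_cases a
  · change totalSpin N 0 ∈ _
    rw [totalSpin_zero_eq]
    exact Subalgebra.smul_mem _ (add_mem raising_mem_spinAlgebra lowering_mem_spinAlgebra) _
  · change totalSpin N 1 ∈ _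
    rw [totalSpin_one_eq]
    exact Subalgebra.smul_mem _ (sub_mem raising_mem_spinAlgebra lowering_mem_spinAlgebra) _
  · exact Algebra.subset_adjoin (by simp)

/-- The operators that act on the ladder over the highest weight `N / 2 - k` through a matrix of
scalars. -/
def ladderSubalgebra (N k : ℕ) : Subalgebra ℂ (Op N) where
  carrier := {A | ∃ R : ℕ → ℕ → ℂ, ∀ i ∈ Finset.range (N - 2 * k + 1),
    A * ladder N k i = ∑ j ∈ Finset.range (N - 2 * k + 1), R j i • ladder N k j}
  mul_mem' := by
    rintro A B ⟨R, hR⟩ ⟨S, hS⟩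
    refine ⟨fun j i => ∑ l ∈ Finset.range (N - 2 * k + 1), R j l * S l i, fun i hi => ?_⟩
    rw [mul_assoc, hS i hi, Finset.mul_sum]
    simp only [Finset.sum_smul]
    rw [Finset.sum_comm]
    refine Finset.sum_congr rfl fun l hl => ?_
    rw [mul_smul_comm, hR l hl, Finset.smul_sum]
    refine Finset.sum_congr rfl fun j _ => ?_
    rw [smul_smul, mul_comm]
  add_mem' := by
    rintro A B ⟨R, hR⟩ ⟨S, hS⟩
    refine ⟨fun j i => R j i + S j i, fun i hi => ?_⟩
    rw [add_mul, hR i hi, hS i hi, ← Finset.sum_add_distrib]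
    simp only [add_smul]
  algebraMap_mem' := by
    intro c
    refine ⟨fun j i => if i = j then c else 0, fun i hi => ?_⟩
    simp only [ite_smul, zero_smul]
    rw [Finset.sum_ite_eq, if_pos hi, Algebra.algebraMap_eq_smul_one, smul_mul_assoc, one_mul]

/-- It suffices to check the generators, whose scalar matrices are those of the spin-`j`
representation. That scalars suffice expresses the trivial action on the multiplicity space. -/
lemma spinAlgebra_le_ladderSubalgebra {k : ℕ} (hk : 2 * k ≤ N) :
    spinAlgebra N ≤ ladderSubalgebra N k := by
  refine Algebra.adjoin_le ?_
  rintro A (rfl | rfl | rfl)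
  · refine ⟨fun j i => if i = j + 1 then
      (√ (ladderNorm (N - 2 * k) i : ℝ) : ℂ)⁻¹ * ((((j : ℂ) + 1) * (((N - 2 * k : ℕ) : ℂ) - j)) *
        (√ (ladderNorm (N - 2 * k) j : ℝ) : ℂ)) else 0, fun i hi => ?_⟩
    simp only [ite_smul, zero_smul]
    rw [Finset.mem_range] at hi
    cases i with
    | zero => simp [ladder_zero, raising_mul_highestWeightProj]
    | succ i =>
      simp only [Nat.add_right_cancel_iff]
      rw [Finset.sum_ite_eq, if_pos (Finset.mem_range.2 (by omega)), ladder, mul_smul_comm,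
        raising_mul_lowering_pow_succ hk, lowering_pow_eq_ladder (by omega : i ≤ N - 2 * k),
        smul_smul, smul_smul, mul_assoc]
  · refine ⟨fun j i => if i + 1 = j then
      (√ (ladderNorm (N - 2 * k) i : ℝ) : ℂ)⁻¹ * (√ (ladderNorm (N - 2 * k) j : ℝ) : ℂ) else 0,
      fun i hi => ?_⟩
    simp only [ite_smul, zero_smul]
    rw [Finset.sum_ite_eq, ladder, mul_smul_comm, ← mul_assoc, ← pow_succ']
    rw [Finset.mem_range] at hi
    split_ifs with h
    · rw [Finset.mem_range] at h
      rw [lowering_pow_eq_ladder (by omega : i + 1 ≤ N - 2 * k), smul_smul]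
    · rw [Finset.mem_range] at h
      rw [lowering_pow_mul_eq_zero hk (by omega), smul_zero]
  · refine ⟨fun j i => if i = j then (N : ℂ) / 2 - k - i else 0, fun i hi => ?_⟩
    simp only [ite_smul, zero_smul]
    rw [Finset.sum_ite_eq, if_pos hi, totalSpin_two_mul_ladder]

/-- The projector onto the sectors of angular momentum `N / 2 - k`, `k ∈ S`. -/
def ladderProj (N : ℕ) (S : Finset ℕ) : Op N :=
  ∑ k ∈ S, ∑ i ∈ Finset.range (N - 2 * k + 1), ladder N k i * (ladder N k i)ᴴ

lemma ladderProj_conjTranspose (S : Finset ℕ) : (ladderProj N S)ᴴ = ladderProj N S := by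
  simp [ladderProj, Matrix.conjTranspose_sum]

lemma ladderProj_mul_ladder {S : Finset ℕ} (hS : ∀ k ∈ S, 2 * k ≤ N) {k i : ℕ} (hk : k ∈ S)
    (hi : i ∈ Finset.range (N - 2 * k + 1)) : ladderProj N S * ladder N k i = ladder N k i := by
  rw [ladderProj, Finset.sum_mul, Finset.sum_eq_single_of_mem k hk]
  · rw [Finset.sum_mul, Finset.sum_eq_single_of_mem i hi]
    · rw [mul_assoc, ladder_conjTranspose_mul (hS k hk) (hS k hk)
        (by rw [Finset.mem_range] at hi; omega), if_pos ⟨rfl, rfl⟩, ladder_mul_highestWeightProj]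
    · intro j hj hji
      rw [mul_assoc, ladder_conjTranspose_mul (hS k hk) (hS k hk)
        (by rw [Finset.mem_range] at hj; omega), if_neg fun h => hji h.2, mul_zero]
  · intro l hl hlk
    rw [Finset.sum_mul]
    refine Finset.sum_eq_zero fun j hj => ?_
    rw [mul_assoc, ladder_conjTranspose_mul (hS l hl) (hS k hk)
      (by rw [Finset.mem_range] at hj; omega), if_neg fun h => hlk h.1, mul_zero]

lemma ladderProj_mul_self {S : Finset ℕ} (hS : ∀ k ∈ S, 2 * k ≤ N) :
    ladderProj N S * ladderProj N S = ladderProj N S := by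
  conv_lhs => rw [ladderProj.eq_def N S, Finset.mul_sum, ← ladderProj]
  rw [ladderProj.eq_def N S]
  refine Finset.sum_congr rfl fun k hk => ?_
  rw [Finset.mul_sum]
  refine Finset.sum_congr rfl fun i hi => ?_
  rw [← mul_assoc, ← ladderProj, ladderProj_mul_ladder hS hk hi]

lemma ladderProj_mul_mul_ladderProj {S : Finset ℕ} (hS : ∀ k ∈ S, 2 * k ≤ N) {A : Op N}
    (hA : A ∈ spinAlgebra N) :
    ladderProj N S * (A * ladderProj N S) = A * ladderProj N S := by
  have h : A * ladderProj N S = ∑ k ∈ S, ∑ i ∈ Finset.range (N - 2 * k + 1),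
      A * (ladder N k i * (ladder N k i)ᴴ) := by
    simp only [ladderProj, Finset.mul_sum]
  rw [h, Finset.mul_sum]
  refine Finset.sum_congr rfl fun k hk => ?_
  obtain ⟨R, hR⟩ := spinAlgebra_le_ladderSubalgebra (hS k hk) hA
  rw [Finset.mul_sum]
  refine Finset.sum_congr rfl fun i hi => ?_
  rw [← mul_assoc A, hR i hi, ← mul_assoc]
  congr 1
  rw [Finset.mul_sum]
  refine Finset.sum_congr rfl fun j hj => ?_
  rw [mul_smul_comm, ladderProj_mul_ladder hS hk hj]

/-- The range of the projector is invariant under `A` and `Aᴴ`, hence reduces `A`. Adjoints permute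
the generators, and the centralizer is an algebra. -/
lemma ladderProj_commute {S : Finset ℕ} (hS : ∀ k ∈ S, 2 * k ≤ N) {A : Op N}
    (hA : A ∈ spinAlgebra N) : A * ladderProj N S = ladderProj N S * A := by
  have key : ∀ A : Op N, A ∈ spinAlgebra N → Aᴴ ∈ spinAlgebra N →
      A ∈ Subalgebra.centralizer ℂ {ladderProj N S} := by
    intro A h1 h2
    rw [Subalgebra.mem_centralizer_iff]
    rintro _ rfl
    have := congrArg Matrix.conjTranspose (ladderProj_mul_mul_ladderProj hS h2)
    rw [Matrix.conjTranspose_mul, Matrix.conjTranspose_mul, ladderProj_conjTranspose,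
      Matrix.conjTranspose_conjTranspose, mul_assoc, ladderProj_mul_mul_ladderProj hS h1] at this
    exact this.symm
  have hle : spinAlgebra N ≤ Subalgebra.centralizer ℂ {ladderProj N S} := by
    refine Algebra.adjoin_le ?_
    rintro A (rfl | rfl | rfl)
    · exact key _ raising_mem_spinAlgebra (raising_conjTranspose ▸ lowering_mem_spinAlgebra)
    · exact key _ lowering_mem_spinAlgebra (lowering_conjTranspose ▸ raising_mem_spinAlgebra)
    · refine key _ (totalSpin_mem_spinAlgebra 2) ?_
      rw [totalSpin_two_conjTranspose]
      exact totalSpin_mem_spinAlgebra 2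
  exact ((Subalgebra.mem_centralizer_iff ℂ).1 (hle hA) _ rfl).symm

end SpinSubalgebra

/-! ### The ladders span the whole space. -/

section Completeness

variable {N : ℕ}

/-- The projector onto the computational-basis vectors of Hamming weight `s`. -/
def weightProj (N s : ℕ) : Op N := Matrix.diagonal fun x => if hammingWeight x = s then 1 else 0

lemma sum_weightProj : ∑ s ∈ Finset.range (N + 1), weightProj N s = 1 := by
  ext x y
  rw [Matrix.sum_apply, Matrix.one_apply]
  simp only [weightProj, Matrix.diagonal_apply]
  split_ifs with h
  · rw [Finset.sum_ite_eq, if_pos (Finset.mem_range.2 (Nat.lt_succ_of_le (hammingWeight_le x)))]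
  · simp

lemma totalSpin_two_mul_weightProj (s : ℕ) :
    totalSpin N 2 * weightProj N s = ((N : ℂ) / 2 - s) • weightProj N s := by
  rw [totalSpin_two_eq_diagonal, weightProj, Matrix.diagonal_mul_diagonal, ← Matrix.diagonal_smul]
  congr 1
  ext x
  by_cases h : hammingWeight x = s <;> simp [h]

lemma raising_apply_ne_zero {x y : Qubits N} (h : raising N x y ≠ 0) :
    hammingWeight y = hammingWeight x + 1 := by
  have h1 := congrFun (congrFun (totalSpin_two_mul_raising (N := N)) x) y
  rw [totalSpin_two_eq_diagonal, Matrix.diagonal_mul, Matrix.add_apply, Matrix.mul_diagonal] at h1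
  have h2 : raising N x y * ((hammingWeight y : ℂ) - (hammingWeight x + 1)) = 0 := by
    linear_combination h1
  have h3 := (mul_eq_zero.1 h2).resolve_left h
  rw [sub_eq_zero] at h3
  exact_mod_cast h3

lemma raising_mul_weightProj_zero : raising N * weightProj N 0 = 0 := by
  ext x y
  rw [weightProj, Matrix.mul_diagonal, Matrix.zero_apply]
  by_cases h : raising N x y = 0
  · rw [h, zero_mul]
  · rw [if_neg (by have := raising_apply_ne_zero h; omega), mul_zero]

lemma raising_mul_weightProj_succ (s : ℕ) :
    raising N * weightProj N (s + 1) = weightProj N s * raising N := by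
  ext x y
  rw [weightProj, weightProj, Matrix.mul_diagonal, Matrix.diagonal_mul]
  by_cases h : raising N x y = 0
  · rw [h, zero_mul, mul_zero]
  · simp [raising_apply_ne_zero h]

/-- Otherwise `J₋ A` would have squared norm `(N - 2s) ‖A‖² < 0`. -/
lemma eq_zero_of_highestWeight_of_neg {s : ℕ} (hs : N < 2 * s) {A : Op N}
    (h₁ : raising N * A = 0) (h₂ : totalSpin N 2 * A = ((N : ℂ) / 2 - s) • A) : A = 0 := by
  have h3 : (lowering N * A)ᴴ * (lowering N * A) = (((N : ℝ) - 2 * s : ℝ) : ℂ) • (Aᴴ * A) := by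
    rw [Matrix.conjTranspose_mul, lowering_conjTranspose, mul_assoc, ← mul_assoc (raising N),
      raising_mul_lowering, add_mul, mul_assoc (lowering N), h₁, mul_zero, zero_add,
      smul_mul_assoc, h₂, smul_smul, mul_smul_comm]
    congr 1
    push_cast
    ring
  have h4 := (Matrix.posSemidef_conjTranspose_mul_self (lowering N * A)).trace_nonneg
  have h5 := (Matrix.posSemidef_conjTranspose_mul_self A).trace_nonneg
  rw [h3, Matrix.trace_smul, smul_eq_mul] at h4
  have h4' := (Complex.le_def.1 h4).1
  have h5' := Complex.le_def.1 h5
  rw [Complex.re_ofReal_mul, Complex.zero_re] at h4'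
  rw [Complex.zero_re, Complex.zero_im] at h5'
  have hneg : (N : ℝ) - 2 * s < 0 := by
    have : (N : ℝ) < 2 * s := by exact_mod_cast hs
    linarith
  have h6 : (Aᴴ * A).trace.re = 0 := by nlinarith [h5'.1]
  rw [← Matrix.trace_conjTranspose_mul_self_eq_zero_iff]
  exact Complex.ext h6 h5'.2.symm

/-- The ladders over all highest weights span the whole space. -/
theorem ladderProj_eq_one : ladderProj N (Finset.range (N / 2 + 1)) = 1 := by
  have hS : ∀ k ∈ Finset.range (N / 2 + 1), 2 * k ≤ N := by
    intro k hk
    rw [Finset.mem_range] at hk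
    omega
  set T := ladderProj N (Finset.range (N / 2 + 1)) with hT
  have hcomm : ∀ A ∈ spinAlgebra N, A * (1 - T) = (1 - T) * A := by
    intro A hA
    rw [mul_sub, sub_mul, ladderProj_commute hS hA, mul_one, one_mul]
  have hM2 : (1 - T) * (1 - T) = 1 - T := by
    simp [mul_sub, sub_mul, hT, ladderProj_mul_self hS]
  -- Induction on the Hamming weight, which `J₊` lowers by one: if `1 - T` vanishes on weight `s`,
  -- then `J₊` kills `(1 - T) * weightProj N (s + 1)`. What remains consists of highest-weight
  -- vectors, and these already lie in the range of `T`.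
  have key : ∀ s, (1 - T) * weightProj N s = 0 := by
    have h1 : ∀ s, raising N * ((1 - T) * weightProj N s) = 0 →
        (1 - T) * weightProj N s = 0 := by
      intro s h1
      have h2 : totalSpin N 2 * ((1 - T) * weightProj N s) =
          ((N : ℂ) / 2 - s) • ((1 - T) * weightProj N s) := by
        rw [← mul_assoc, hcomm _ (totalSpin_mem_spinAlgebra 2), mul_assoc,
          totalSpin_two_mul_weightProj, mul_smul_comm]
      rcases le_or_gt (2 * s) N with hs | hs
      · have h3 := highestWeightProj_mul_eq h1 h2
        have h4 : (1 - T) * highestWeightProj N s = 0 := by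
          rw [sub_mul, one_mul, hT, ← ladder_zero, ladderProj_mul_ladder hS
            (Finset.mem_range.2 (by omega)) (Finset.mem_range.2 (by omega)), sub_self]
        calc (1 - T) * weightProj N s = (1 - T) * ((1 - T) * weightProj N s) := by
              rw [← mul_assoc, hM2]
          _ = 0 := by rw [← h3, ← mul_assoc, h4, zero_mul]
      · exact eq_zero_of_highestWeight_of_neg hs h1 h2
    intro s
    induction s with
    | zero =>
      apply h1
      rw [← mul_assoc, hcomm _ raising_mem_spinAlgebra, mul_assoc, raising_mul_weightProj_zero,
        mul_zero]
    | succ s ih =>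
      apply h1
      rw [← mul_assoc, hcomm _ raising_mem_spinAlgebra, mul_assoc, raising_mul_weightProj_succ,
        ← mul_assoc, ih, zero_mul]
  have h0 : (1 - T) = 0 := by
    calc 1 - T = (1 - T) * ∑ s ∈ Finset.range (N + 1), weightProj N s := by
          rw [sum_weightProj, mul_one]
      _ = 0 := ?_
    rw [Finset.mul_sum]
    exact Finset.sum_eq_zero fun s _ => key s
  exact (sub_eq_zero.1 h0).symm

end Completeness

/-! ### Rotating the Bloch vector to the z axis. -/

section Rotation

variable {N : ℕ}

/-- The operator `n · σ`. -/
def blochMatrix (n : EuclideanSpace ℝ (Fin 3)) : Matrix (Fin 2) (Fin 2) ℂ :=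
  ∑ a, (n a : ℂ) • pauli a

lemma blochMatrix_eq (n : EuclideanSpace ℝ (Fin 3)) :
    blochMatrix n = !![(n 2 : ℂ), n 0 - n 1 * Complex.I; n 0 + n 1 * Complex.I, -(n 2 : ℂ)] := by
  ext i j
  rw [blochMatrix, Fin.sum_univ_three]
  fin_cases i <;> fin_cases j <;> (simp [pauli]; try ring)

lemma sphere_sq_sum (n : BlochSphere) : n.1 0 ^ 2 + n.1 1 ^ 2 + n.1 2 ^ 2 = 1 := by
  have h := n.2
  rw [mem_sphere_zero_iff_norm, EuclideanSpace.norm_eq, Real.sqrt_eq_one, Fin.sum_univ_three] at h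
  simpa using h

lemma blochMatrix_conjTranspose (n : EuclideanSpace ℝ (Fin 3)) :
    (blochMatrix n)ᴴ = blochMatrix n := by
  rw [blochMatrix_eq]
  ext i j
  fin_cases i <;> fin_cases j <;> simp [sub_eq_add_neg]

lemma blochMatrix_mul_self {n : EuclideanSpace ℝ (Fin 3)}
    (hn : n 0 ^ 2 + n 1 ^ 2 + n 2 ^ 2 = 1) : blochMatrix n * blochMatrix n = 1 := by
  have hc : (n 0 : ℂ) ^ 2 + (n 1 : ℂ) ^ 2 + (n 2 : ℂ) ^ 2 = 1 := by
    rw [← Complex.ofReal_one, ← hn]; push_cast; rfl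
  rw [blochMatrix_eq]
  ext i j
  fin_cases i <;> fin_cases j <;> simp [Matrix.mul_apply, Fin.sum_univ_two]
  · linear_combination hc - (n 1 : ℂ) ^ 2 * Complex.I_sq
  · ring
  · ring
  · linear_combination hc - (n 1 : ℂ) ^ 2 * Complex.I_sq

/-- The half turn about the bisector of `n` and the z axis exchanges the two. The bisector is `n +
e_z` divided by its norm `√(2 + 2 n_z)`; for `n = -e_z` it does not exist and the x axis serves. -/
lemma exists_blochMatrix_rotation (n : BlochSphere) : ∃ m : EuclideanSpace ℝ (Fin 3),
    m 0 ^ 2 + m 1 ^ 2 + m 2 ^ 2 = 1 ∧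
      blochMatrix m * pauli 2 = blochMatrix n.1 * blochMatrix m := by
  have hn := sphere_sq_sum n
  by_cases h : n.1 2 = -1
  · have h0 : n.1 0 = 0 := by rw [h] at hn; nlinarith [sq_nonneg (n.1 0), sq_nonneg (n.1 1)]
    have h1 : n.1 1 = 0 := by rw [h] at hn; nlinarith [sq_nonneg (n.1 0), sq_nonneg (n.1 1)]
    refine ⟨!₂[1, 0, 0], by simp, ?_⟩
    rw [blochMatrix_eq, blochMatrix_eq, h, h0, h1]
    ext i j
    fin_cases i <;> fin_cases j <;> simp [pauli]
  · have hpos : 0 < 2 + 2 * n.1 2 := by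
      have h1 : -1 ≤ n.1 2 := by nlinarith [sq_nonneg (n.1 0), sq_nonneg (n.1 1)]
      have h2 : -1 < n.1 2 := lt_of_le_of_ne h1 (Ne.symm h)
      linarith
    set s := √ (2 + 2 * n.1 2) with hs
    have hs2 : s ^ 2 = 2 + 2 * n.1 2 := Real.sq_sqrt hpos.le
    have hs0 : s ≠ 0 := (Real.sqrt_pos.2 hpos).ne'
    refine ⟨s⁻¹ • !₂[n.1 0, n.1 1, n.1 2 + 1], ?_, ?_⟩
    · simp only [PiLp.smul_apply, smul_eq_mul, mul_pow, ← mul_add, inv_pow, hs2]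
      simp only [Matrix.cons_val_zero, Matrix.cons_val_one, Matrix.cons_val]
      rw [inv_mul_eq_one₀ hpos.ne']
      linear_combination -hn
    · have e : blochMatrix (s⁻¹ • !₂[n.1 0, n.1 1, n.1 2 + 1]) =
          ((s⁻¹ : ℝ) : ℂ) • (blochMatrix n.1 + pauli 2) := by
        rw [blochMatrix_eq, blochMatrix_eq]
        ext i j
        fin_cases i <;> fin_cases j <;> simp [pauli] <;> ring
      have hz : pauli 2 * pauli 2 = 1 := by
        ext i j
        fin_cases i <;> fin_cases j <;> simp [pauli]
      rw [e, smul_mul_assoc, mul_smul_comm, add_mul, mul_add, hz, blochMatrix_mul_self hn, add_comm]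

lemma aeval_diagonal {ι : Type*} [Fintype ι] [DecidableEq ι] (d : ι → ℂ) (g : Polynomial ℂ) :
    Polynomial.aeval (Matrix.diagonal d) g = Matrix.diagonal fun i => g.eval (d i) := by
  have h := Polynomial.aeval_algHom_apply (Matrix.diagonalAlgHom (n := ι) ℂ) d g
  rw [Matrix.diagonalAlgHom_apply] at h
  rw [h, Matrix.diagonalAlgHom_apply]
  congr 1
  ext i
  have h2 := Polynomial.aeval_algHom_apply (Pi.evalAlgHom ℂ (fun _ : ι => ℂ) i) d g
  simp only [Pi.evalAlgHom_apply] at h2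
  rw [← h2, Polynomial.coe_aeval_eq_eval]

lemma exists_aeval_totalSpin_two (f : ℕ → ℂ) : ∃ g : Polynomial ℂ,
    (Matrix.diagonal fun x => f (hammingWeight x) : Op N) = Polynomial.aeval (totalSpin N 2) g := by
  refine ⟨Lagrange.interpolate (Finset.range (N + 1)) (fun s : ℕ => (N : ℂ) / 2 - s) f, ?_⟩
  rw [totalSpin_two_eq_diagonal, aeval_diagonal]
  congr 1
  ext x
  refine (Lagrange.eval_interpolate_at_node (v := fun s : ℕ => (N : ℂ) / 2 - s) f ?_ ?_).symm
  · intro a _ b _ hab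
    have : (a : ℂ) = b := by simpa using hab
    exact_mod_cast this
  · exact Finset.mem_range.2 (Nat.lt_succ_of_le (hammingWeight_le x))

lemma mul_aeval_of_semiconj {A : Type*} [Ring A] [Algebra ℂ A] {U X Y : A} (h : U * X = Y * U)
    (g : Polynomial ℂ) : U * Polynomial.aeval X g = Polynomial.aeval Y g * U := by
  induction g using Polynomial.induction_on' with
  | add p q hp hq => rw [map_add, map_add, mul_add, add_mul, hp, hq]
  | monomial n a =>
    rw [Polynomial.aeval_monomial, Polynomial.aeval_monomial, ← mul_assoc, ← Algebra.commutes,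
      mul_assoc, mul_assoc]
    congr 1
    exact (SemiconjBy.pow_right (show SemiconjBy U X Y from h) n).eq

lemma one_add_pauli_eq_diagonal (α β : ℂ) :
    α • (1 : Matrix (Fin 2) (Fin 2) ℂ) + β • pauli 2 = Matrix.diagonal ![α + β, α - β] := by
  ext i j
  fin_cases i <;> fin_cases j <;> simp [pauli, sub_eq_add_neg]

lemma rotation_conj {m n : EuclideanSpace ℝ (Fin 3)} (hm : m 0 ^ 2 + m 1 ^ 2 + m 2 ^ 2 = 1)
    (h : blochMatrix m * pauli 2 = blochMatrix n * blochMatrix m) (α β : ℂ) :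
    α • (1 : Matrix (Fin 2) (Fin 2) ℂ) + β • blochMatrix n =
      blochMatrix m * (α • (1 : Matrix (Fin 2) (Fin 2) ℂ) + β • pauli 2) * blochMatrix m := by
  rw [mul_add, mul_smul_comm, mul_smul_comm, mul_one, h, add_mul, smul_mul_assoc, smul_mul_assoc,
    mul_assoc, blochMatrix_mul_self hm, mul_one]

/-- For `n` along z the tensor power is a function of the Hamming weight, hence by interpolation a
polynomial in `J_z`. Conjugation by the tensor power of the half turn makes it the same polynomial
in `n · J`. -/
lemma tensorPower_mem_spinAlgebra (n : BlochSphere) (α β : ℂ) :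
    tensorPower N (α • (1 : Matrix (Fin 2) (Fin 2) ℂ) + β • blochMatrix n.1) ∈ spinAlgebra N := by
  obtain ⟨m, hm, hmn⟩ := exists_blochMatrix_rotation n
  obtain ⟨g, hg⟩ := exists_aeval_totalSpin_two (N := N)
    fun s => (α + β) ^ (N - s) * (α - β) ^ s
  have hJ : tensorPower N (blochMatrix m) * totalSpin N 2 =
      collective N ((1 / 2 : ℂ) • blochMatrix n.1) * tensorPower N (blochMatrix m) := by
    rw [totalSpin_eq_collective]
    refine tensorPower_mul_collective ?_
    rw [mul_smul_comm, smul_mul_assoc, hmn]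
  rw [rotation_conj hm hmn, ← tensorPower_mul, ← tensorPower_mul, one_add_pauli_eq_diagonal,
    tensorPower_diagonal, hg, mul_aeval_of_semiconj hJ, mul_assoc, tensorPower_mul,
    blochMatrix_mul_self hm, tensorPower_one, mul_one]
  have hmem : collective N ((1 / 2 : ℂ) • blochMatrix n.1) ∈ spinAlgebra N := by
    rw [blochMatrix, Finset.smul_sum, map_sum]
    refine sum_mem fun a _ => ?_
    rw [smul_comm, map_smul, ← totalSpin_eq_collective]
    exact Subalgebra.smul_mem _ (totalSpin_mem_spinAlgebra a) _
  exact Algebra.adjoin_le (Set.singleton_subset_iff.2 hmem)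
    (Polynomial.aeval_mem_adjoin_singleton ℂ _)

lemma qubitState_eq (p : ℝ) (n : BlochSphere) :
    qubitState p n = (1 / 2 : ℂ) • (1 : Matrix (Fin 2) (Fin 2) ℂ) +
      ((p : ℂ) - 1 / 2) • blochMatrix n.1 := by
  have h : ∀ v : EuclideanSpace ℝ (Fin 3), pureState v = (1 / 2 : ℂ) • (1 + blochMatrix v) :=
    fun v => rfl
  have hneg : blochMatrix (-n.1) = -blochMatrix n.1 := by
    simp [blochMatrix]
  rw [qubitState, h, h, hneg]
  push_cast
  module

lemma tensorPower_qubitState_mem (p : ℝ) (n : BlochSphere) :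
    tensorPower N (qubitState p n) ∈ spinAlgebra N := by
  rw [qubitState_eq]
  exact tensorPower_mem_spinAlgebra n _ _

/-- That `U` lies in the spin algebra makes it commute with `ladderProj`, so the sector
probabilities do not depend on the Bloch vector. -/
lemma exists_tensorPower_qubitState_eq (p : ℝ) (n : BlochSphere) :
    ∃ U ∈ spinAlgebra N, Uᴴ = U ∧ U * U = 1 ∧ tensorPower N (qubitState p n) =
      U * tensorPower N (Matrix.diagonal ![(p : ℂ), 1 - p]) * U := by
  obtain ⟨m, hm, hmn⟩ := exists_blochMatrix_rotation n
  have hms : m ∈ Metric.sphere (0 : EuclideanSpace ℝ (Fin 3)) 1 := by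
    rw [mem_sphere_zero_iff_norm, EuclideanSpace.norm_eq, Real.sqrt_eq_one, Fin.sum_univ_three]
    simpa using hm
  refine ⟨tensorPower N (blochMatrix m), ?_, ?_, ?_, ?_⟩
  · have := tensorPower_mem_spinAlgebra (N := N) ⟨m, hms⟩ 0 1
    rwa [zero_smul, one_smul, zero_add] at this
  · rw [tensorPower_conjTranspose, blochMatrix_conjTranspose]
  · rw [tensorPower_mul, blochMatrix_mul_self hm, tensorPower_one]
  · rw [qubitState_eq, rotation_conj hm hmn, one_add_pauli_eq_diagonal, tensorPower_mul,
      tensorPower_mul]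
    congr 4
    ext i
    fin_cases i <;> simp
    ring

lemma tensorPower_qubitState_posSemidef {p : ℝ} (hp : 0 ≤ p) (hp1 : p ≤ 1) (n : BlochSphere) :
    (tensorPower N (qubitState p n)).PosSemidef := by
  obtain ⟨U, -, hU, -, h⟩ := exists_tensorPower_qubitState_eq (N := N) p n
  rw [h]
  have hd : (tensorPower N (Matrix.diagonal ![(p : ℂ), 1 - p])).PosSemidef := by
    rw [tensorPower_diagonal]
    refine Matrix.PosSemidef.diagonal fun x => ?_
    have h1 : (0 : ℂ) ≤ p := by exact_mod_cast hp
    have h2 : (0 : ℂ) ≤ 1 - p := by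
      have : (0 : ℝ) ≤ 1 - p := by linarith
      exact_mod_cast this
    exact mul_nonneg (pow_nonneg h1 _) (pow_nonneg h2 _)
  have := hd.mul_mul_conjTranspose_same U
  rwa [hU] at this

/-! ### Sector multiplicities and their generating identity. -/

lemma ladder_apply_ne_zero {k i : ℕ} {x y : Qubits N} (h : ladder N k i x y ≠ 0) :
    hammingWeight x = k + i := by
  have h1 := congrFun (congrFun (totalSpin_two_mul_ladder (N := N) k i) x) y
  rw [totalSpin_two_eq_diagonal, Matrix.diagonal_mul, Matrix.smul_apply, smul_eq_mul] at h1
  have h2 := mul_right_cancel₀ h h1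
  have h3 : (hammingWeight x : ℂ) = k + i := by linear_combination -h2
  exact_mod_cast h3

lemma diagonal_mul_ladder (f : ℕ → ℂ) (k i : ℕ) :
    Matrix.diagonal (fun x => f (hammingWeight x)) * ladder N k i = f (k + i) • ladder N k i := by
  ext x y
  rw [Matrix.diagonal_mul, Matrix.smul_apply, smul_eq_mul]
  by_cases h : ladder N k i x y = 0
  · rw [h, mul_zero, mul_zero]
  · rw [ladder_apply_ne_zero h]

lemma ladderProj_mul_diagonal_trace {S : Finset ℕ} (hS : ∀ k ∈ S, 2 * k ≤ N) (a b : ℂ) :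
    (ladderProj N S * tensorPower N (Matrix.diagonal ![a, b])).trace =
      ∑ k ∈ S, ∑ i ∈ Finset.range (N - 2 * k + 1),
        (highestWeightProj N k).trace * (a ^ (N - (k + i)) * b ^ (k + i)) := by
  rw [ladderProj, Finset.sum_mul, Matrix.trace_sum]
  refine Finset.sum_congr rfl fun k hk => ?_
  rw [Finset.sum_mul, Matrix.trace_sum]
  refine Finset.sum_congr rfl fun i hi => ?_
  rw [Finset.mem_range] at hi
  rw [mul_assoc, Matrix.trace_mul_comm, mul_assoc, tensorPower_diagonal,
    diagonal_mul_ladder (fun s => a ^ (N - s) * b ^ s), mul_smul_comm,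
    ladder_conjTranspose_mul (hS k hk) (hS k hk) (by omega), if_pos ⟨rfl, rfl⟩, Matrix.trace_smul,
    smul_eq_mul, mul_comm]

/-- The sectorMultiplicity of the sector of angular momentum `N / 2 - k`. -/
def sectorMultiplicity (N k : ℕ) : ℝ := (highestWeightProj N k).trace.re

lemma highestWeightProj_posSemidef (k : ℕ) : (highestWeightProj N k).PosSemidef := by
  have := Matrix.posSemidef_conjTranspose_mul_self (highestWeightProj N k)
  rwa [highestWeightProj_conjTranspose, highestWeightProj_mul_self] at this

lemma highestWeightProj_trace (k : ℕ) :
    (highestWeightProj N k).trace = (sectorMultiplicity N k : ℂ) :=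
  Complex.ext rfl (Complex.le_def.1 (highestWeightProj_posSemidef k).trace_nonneg).2.symm

lemma sectorMultiplicity_nonneg (k : ℕ) : 0 ≤ sectorMultiplicity N k :=
  (Complex.le_def.1 (highestWeightProj_posSemidef k).trace_nonneg).1

/-- The trace of `diag(a, b)^⊗N`, resolved over the ladders. Replacing `b` by `b * exp t` turns it
into a moment generating function, so no formula for the multiplicities is needed. -/
lemma sum_sectorMultiplicity_mul (a b : ℝ) :
    ∑ k ∈ Finset.range (N / 2 + 1), ∑ i ∈ Finset.range (N - 2 * k + 1),
      sectorMultiplicity N k * (a ^ (N - (k + i)) * b ^ (k + i)) = (a + b) ^ N := by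
  have h := ladderProj_mul_diagonal_trace (N := N) (S := Finset.range (N / 2 + 1))
    (fun k hk => by rw [Finset.mem_range] at hk; omega) (a : ℂ) (b : ℂ)
  rw [ladderProj_eq_one, one_mul, tensorPower_trace, Matrix.trace_diagonal, Fin.sum_univ_two] at h
  simp only [highestWeightProj_trace, Matrix.cons_val_zero, Matrix.cons_val_one] at h
  exact_mod_cast h.symm

lemma one_sub_ladderProj_mul_trace {S : Finset ℕ} (hS : S ⊆ Finset.range (N / 2 + 1)) (p : ℝ)
    (n : BlochSphere) :
    ((1 - ladderProj N S) * tensorPower N (qubitState p n)).trace.re =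
      ∑ k ∈ Finset.range (N / 2 + 1) \ S, ∑ i ∈ Finset.range (N - 2 * k + 1),
        sectorMultiplicity N k * (p ^ (N - (k + i)) * (1 - p) ^ (k + i)) := by
  have hle : ∀ k ∈ Finset.range (N / 2 + 1), 2 * k ≤ N := fun k hk => by
    rw [Finset.mem_range] at hk; omega
  have h1 : 1 - ladderProj N S = ladderProj N (Finset.range (N / 2 + 1) \ S) := by
    rw [← ladderProj_eq_one, sub_eq_iff_eq_add, ladderProj, ladderProj, ladderProj,
      Finset.sum_sdiff hS]
  have hS' : ∀ k ∈ Finset.range (N / 2 + 1) \ S, 2 * k ≤ N :=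
    fun k hk => hle k (Finset.sdiff_subset hk)
  obtain ⟨U, hU, -, hUU, h⟩ := exists_tensorPower_qubitState_eq (N := N) p n
  rw [h1, h, mul_assoc U, ← mul_assoc, ← ladderProj_commute hS' hU, mul_assoc,
    Matrix.trace_mul_comm, mul_assoc, mul_assoc, hUU, mul_one,
    ladderProj_mul_diagonal_trace hS']
  simp only [highestWeightProj_trace]
  rw [← Complex.ofReal_re (∑ k ∈ Finset.range (N / 2 + 1) \ S, _)]
  push_cast
  rfl

end Rotation

/-! ### Chernoff bounds for the sector probabilities. -/

section Estimates

/-- Hoeffding's lemma for a Bernoulli variable of mean `q`: range of length 1, variance proxy 1/4.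
-/
lemma bernoulli_mgf_le {q : ℝ} (h0 : 0 ≤ q) (h1 : q ≤ 1) (t : ℝ) :
    (1 - q) + q * Real.exp t ≤ Real.exp (t * q + t ^ 2 / 8) := by
  let X : Bool → ℝ := fun b => if b then 1 else 0
  let ν : Measure Bool :=
    ENNReal.ofReal (1 - q) • Measure.dirac false + ENNReal.ofReal q • Measure.dirac true
  have hν : IsProbabilityMeasure ν := ⟨by
    simp only [ν, Measure.coe_add, Measure.coe_smul, Pi.add_apply, Pi.smul_apply, measure_univ,
      smul_eq_mul, mul_one]
    rw [← ENNReal.ofReal_add (by linarith) h0]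
    simp⟩
  have hint : ∀ f : Bool → ℝ, ∫ b, f b ∂ν = (1 - q) * f false + q * f true := by
    intro f
    rw [integral_add_measure (Integrable.smul_measure (integrable_dirac (by simp)) (by simp))
      (Integrable.smul_measure (integrable_dirac (by simp)) (by simp)), integral_smul_measure,
      integral_smul_measure, integral_dirac, integral_dirac, ENNReal.toReal_ofReal (by linarith),
      ENNReal.toReal_ofReal h0, smul_eq_mul, smul_eq_mul]
  have hX : ∀ᵐ b ∂ν, X b ∈ Set.Icc (0 : ℝ) 1 :=
    Filter.Eventually.of_forall fun b => by cases b <;> simp [X]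
  have h := (ProbabilityTheory.hasSubgaussianMGF_of_mem_Icc
    (measurable_of_countable X).aemeasurable hX).mgf_le t
  rw [ProbabilityTheory.mgf, hint, hint] at h
  simp only [X, if_true, Bool.false_eq_true, if_false, mul_zero, mul_one, zero_add] at h
  have h2 := mul_le_mul_of_nonneg_left h (Real.exp_pos (t * q)).le
  have e1 : Real.exp (t * q) * Real.exp (t * (0 - q)) = 1 := by
    rw [← Real.exp_add]; ring_nf; exact Real.exp_zero
  have e2 : Real.exp (t * q) * Real.exp (t * (1 - q)) = Real.exp t := by
    rw [← Real.exp_add]; ring_nf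
  rw [← Real.exp_add] at h2
  calc (1 - q) + q * Real.exp t
      = Real.exp (t * q) * ((1 - q) * Real.exp (t * (0 - q)) + q * Real.exp (t * (1 - q))) := by
        rw [mul_add, mul_left_comm, e1, mul_left_comm, e2, mul_one]
    _ ≤ _ := h2
    _ = _ := by
        congr 1
        simp
        ring

variable {N : ℕ} {p : ℝ}

/-- The probability of the sector of angular momentum `N / 2 - k` in the state
`ρ ^ ⊗ N`. -/
def sectorProb (N : ℕ) (p : ℝ) (k : ℕ) : ℝ :=
  ∑ i ∈ Finset.range (N - 2 * k + 1),
    sectorMultiplicity N k * (p ^ (N - (k + i)) * (1 - p) ^ (k + i))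

/-- The probability weights of the sectors, exponentially tilted by the weight. -/
def tiltedProb (N : ℕ) (p t : ℝ) (k : ℕ) : ℝ :=
  ∑ i ∈ Finset.range (N - 2 * k + 1),
    sectorMultiplicity N k * (p ^ (N - (k + i)) * ((1 - p) * Real.exp t) ^ (k + i))

lemma tiltedProb_nonneg (hp : 0 ≤ p) (hp1 : p ≤ 1) (t : ℝ) (k : ℕ) : 0 ≤ tiltedProb N p t k :=
  Finset.sum_nonneg fun i _ => mul_nonneg (sectorMultiplicity_nonneg k)
    (mul_nonneg (pow_nonneg hp _)
      (pow_nonneg (mul_nonneg (by linarith) (Real.exp_pos t).le) _))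

lemma sum_tiltedProb_le (hp : 0 ≤ p) (hp1 : p ≤ 1) (t : ℝ) {A : Finset ℕ}
    (hA : A ⊆ Finset.range (N / 2 + 1)) :
    ∑ k ∈ A, tiltedProb N p t k ≤ Real.exp (N * (t * (1 - p) + t ^ 2 / 8)) := by
  calc ∑ k ∈ A, tiltedProb N p t k ≤ ∑ k ∈ Finset.range (N / 2 + 1), tiltedProb N p t k :=
        Finset.sum_le_sum_of_subset_of_nonneg hA fun k _ _ => tiltedProb_nonneg hp hp1 t k
    _ = (p + (1 - p) * Real.exp t) ^ N := sum_sectorMultiplicity_mul _ _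
    _ ≤ (Real.exp (t * (1 - p) + t ^ 2 / 8)) ^ N := by
        refine pow_le_pow_left₀ (add_nonneg hp (mul_nonneg (by linarith) (Real.exp_pos t).le)) ?_ N
        have := bernoulli_mgf_le (q := 1 - p) (by linarith) (by linarith) t
        rwa [sub_sub_cancel] at this
    _ = _ := by rw [← Real.exp_nat_mul]

/-- Chernoff bound for the sectors of small angular momentum. -/
lemma sum_sectorProb_le_of_le (hp : 0 ≤ p) (hp1 : p ≤ 1) {t u : ℝ} (ht : 0 ≤ t) {A : Finset ℕ}
    (hA : A ⊆ Finset.range (N / 2 + 1)) (hu : ∀ k ∈ A, N * (1 - p) + u ≤ k) :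
    ∑ k ∈ A, sectorProb N p k ≤ Real.exp (N * t ^ 2 / 8 - t * u) := by
  have h1 : ∀ k ∈ A, sectorProb N p k ≤
      Real.exp (-(t * (N * (1 - p) + u))) * tiltedProb N p t k := by
    intro k hk
    rw [sectorProb, tiltedProb, Finset.mul_sum]
    refine Finset.sum_le_sum fun i _ => ?_
    rw [mul_left_comm (Real.exp _)]
    refine mul_le_mul_of_nonneg_left ?_ (sectorMultiplicity_nonneg k)
    rw [mul_left_comm (Real.exp _)]
    refine mul_le_mul_of_nonneg_left ?_ (pow_nonneg hp _)
    rw [mul_pow, mul_left_comm, ← Real.exp_nat_mul, ← Real.exp_add]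
    refine le_mul_of_one_le_right (pow_nonneg (by linarith) _) (Real.one_le_exp ?_)
    -- Every Hamming weight `k + i` in the sector is at least `k`, so here tilting by the weight
    -- loses nothing.
    have h2 : N * (1 - p) + u ≤ ((k + i : ℕ) : ℝ) := by
      have := hu k hk
      push_cast
      have : (0 : ℝ) ≤ i := Nat.cast_nonneg i
      linarith
    nlinarith
  calc _ ≤ ∑ k ∈ A, Real.exp (-(t * (N * (1 - p) + u))) * tiltedProb N p t k :=
        Finset.sum_le_sum h1
    _ ≤ Real.exp (-(t * (N * (1 - p) + u))) * Real.exp (N * (t * (1 - p) + t ^ 2 / 8)) := by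
        rw [← Finset.mul_sum]
        exact mul_le_mul_of_nonneg_left (sum_tiltedProb_le hp hp1 t hA) (Real.exp_pos _).le
    _ = _ := by rw [← Real.exp_add]; congr 1; ring

/-- The products `(1 - x) ∑ x ^ i = 1 - x ^ d` decrease in `x`. This bounds the cost of tilting by
the weight `k + i` instead of by `k`. -/
lemma geom_sum_le_mul_geom_sum {x y : ℝ} (hy : 0 ≤ y) (hyx : y ≤ x) (hx : x < 1) (d : ℕ) :
    ∑ i ∈ Finset.range d, x ^ i ≤ (1 - y) / (1 - x) * ∑ i ∈ Finset.range d, y ^ i := by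
  have h1 : 0 < 1 - x := by linarith
  rw [div_mul_eq_mul_div, le_div_iff₀ h1, mul_comm (1 - y), geom_sum_mul_neg, geom_sum_mul_neg]
  have := pow_le_pow_left₀ hy hyx d
  linarith

/-- Chernoff bound for the sectors of large angular momentum. -/
lemma sum_sectorProb_le_of_ge (hp : 1 / 2 < p) (hp1 : p ≤ 1) {t u : ℝ} (ht : 0 ≤ t)
    {A : Finset ℕ} (hA : A ⊆ Finset.range (N / 2 + 1)) (hu : ∀ k ∈ A, k ≤ N * (1 - p) - u) :
    ∑ k ∈ A, sectorProb N p k ≤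
      (1 - (1 - p) / p * Real.exp (-t)) / (1 - (1 - p) / p) * Real.exp (N * t ^ 2 / 8 - t * u) := by
  have hp0 : 0 < p := by linarith
  have hx0 : 0 ≤ (1 - p) / p := div_nonneg (by linarith) hp0.le
  have hx1 : (1 - p) / p < 1 := by rw [div_lt_one hp0]; linarith
  have hy0 : 0 ≤ (1 - p) / p * Real.exp (-t) := mul_nonneg hx0 (Real.exp_pos _).le
  have hyx : (1 - p) / p * Real.exp (-t) ≤ (1 - p) / p :=
    mul_le_of_le_one_right hx0 (Real.exp_le_one_iff.2 (by linarith))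
  set x := (1 - p) / p with hx
  set C := (1 - x * Real.exp (-t)) / (1 - x) with hC
  have hC0 : 0 ≤ C := div_nonneg (by linarith) (by linarith)
  -- Here the weights `k + i ≥ k` go the wrong way. As `p > 1/2`, they are distributed geometrically
  -- with ratio `x < 1` above `k`, so the loss is a factor `C`, which tends to 1 as `t → 0`.
  have h1 : ∀ k ∈ A, sectorProb N p k ≤
      C * Real.exp (t * (N * (1 - p) - u)) * tiltedProb N p (-t) k := by
    intro k hk
    have hk2 := hA hk
    rw [Finset.mem_range] at hk2
    have hpow : ∀ b : ℝ, ∀ i ∈ Finset.range (N - 2 * k + 1),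
        p ^ (N - (k + i)) * b ^ (k + i) = p ^ (N - k) * b ^ k * (b / p) ^ i := by
      intro b i hi
      rw [Finset.mem_range] at hi
      have : p ^ (N - k) = p ^ (N - (k + i)) * p ^ i := by rw [← pow_add]; congr 1; omega
      rw [this, div_pow, pow_add]
      field_simp
    have e1 : sectorProb N p k = sectorMultiplicity N k * (p ^ (N - k) * (1 - p) ^ k) *
        ∑ i ∈ Finset.range (N - 2 * k + 1), x ^ i := by
      rw [sectorProb, Finset.mul_sum]
      refine Finset.sum_congr rfl fun i hi => ?_
      rw [hpow _ i hi]
      ring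
    have e2 : tiltedProb N p (-t) k = Real.exp (-(t * k)) *
        (sectorMultiplicity N k * (p ^ (N - k) * (1 - p) ^ k) *
        ∑ i ∈ Finset.range (N - 2 * k + 1), (x * Real.exp (-t)) ^ i) := by
      rw [tiltedProb, Finset.mul_sum, Finset.mul_sum]
      refine Finset.sum_congr rfl fun i hi => ?_
      rw [hpow _ i hi, mul_pow _ _ k, ← Real.exp_nat_mul, mul_div_right_comm,
        show (k : ℝ) * -t = -(t * k) by ring]
      ring
    have hB : 0 ≤ sectorMultiplicity N k * (p ^ (N - k) * (1 - p) ^ k) :=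
      mul_nonneg (sectorMultiplicity_nonneg k)
        (mul_nonneg (pow_nonneg hp0.le _) (pow_nonneg (by linarith) _))
    rw [e1, e2]
    have hexp : 1 ≤ Real.exp (t * (N * (1 - p) - u)) * Real.exp (-(t * k)) := by
      rw [← Real.exp_add]
      refine Real.one_le_exp ?_
      have := hu k hk
      nlinarith
    have hG : 0 ≤ ∑ i ∈ Finset.range (N - 2 * k + 1), (x * Real.exp (-t)) ^ i :=
      Finset.sum_nonneg fun i _ => pow_nonneg hy0 i
    calc _ ≤ sectorMultiplicity N k * (p ^ (N - k) * (1 - p) ^ k) *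
          (C * ∑ i ∈ Finset.range (N - 2 * k + 1), (x * Real.exp (-t)) ^ i) :=
          mul_le_mul_of_nonneg_left (geom_sum_le_mul_geom_sum hy0 hyx hx1 _) hB
      _ ≤ sectorMultiplicity N k * (p ^ (N - k) * (1 - p) ^ k) *
          (C * ∑ i ∈ Finset.range (N - 2 * k + 1), (x * Real.exp (-t)) ^ i) *
          (Real.exp (t * (N * (1 - p) - u)) * Real.exp (-(t * k))) :=
          le_mul_of_one_le_right (mul_nonneg hB (mul_nonneg hC0 hG)) hexp
      _ = _ := by ring
  calc _ ≤ ∑ k ∈ A, C * Real.exp (t * (N * (1 - p) - u)) * tiltedProb N p (-t) k :=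
        Finset.sum_le_sum h1
    _ ≤ C * Real.exp (t * (N * (1 - p) - u)) *
        Real.exp (N * (-t * (1 - p) + (-t) ^ 2 / 8)) := by
        rw [← Finset.mul_sum]
        exact mul_le_mul_of_nonneg_left (sum_tiltedProb_le hp0.le hp1 (-t) hA)
          (mul_nonneg hC0 (Real.exp_pos _).le)
    _ = _ := by
        rw [mul_assoc, ← Real.exp_add]
        congr 2
        ring

/-- The indices `k` of the angular momenta `N / 2 - k ≥ 0` at distance at most `w` from `c` that
occur with non-zero multiplicity. -/
def windowIndices (N : ℕ) (c w : ℝ) : Finset ℕ :=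
  (Finset.range (N / 2 + 1)).filter fun k => |(N : ℝ) / 2 - k - c| ≤ w ∧ sectorMultiplicity N k ≠ 0

lemma windowIndices_subset (c w : ℝ) : windowIndices N c w ⊆ Finset.range (N / 2 + 1) :=
  Finset.filter_subset _ _

lemma sum_sectorProb_compl_windowIndices_le (hp : 1 / 2 < p) (hp1 : p ≤ 1) {t w : ℝ}
    (ht : 0 ≤ t) :
    ∑ k ∈ Finset.range (N / 2 + 1) \ windowIndices N ((p - 1 / 2) * (N + 1)) w,
        sectorProb N p k ≤
      Real.exp (N * t ^ 2 / 8 - t * (w - 1 / 2)) +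
      (1 - (1 - p) / p * Real.exp (-t)) / (1 - (1 - p) / p) * Real.exp (N * t ^ 2 / 8 - t * w) := by
  set c := (p - 1 / 2) * ((N : ℝ) + 1) with hc
  -- The centre in terms of `k` is `N/2 - c = N(1 - p) - (p - 1/2)`. The shift `p - 1/2` is at most
  -- 1/2, which is given up on this side, and helps on the other.
  set A := (Finset.range (N / 2 + 1)).filter fun k : ℕ => N * (1 - p) + (w - 1 / 2) ≤ k
  set B := (Finset.range (N / 2 + 1)).filter fun k : ℕ => (k : ℝ) ≤ N * (1 - p) - w
  have h0 : ∀ k, 0 ≤ sectorProb N p k := fun k => Finset.sum_nonneg fun i _ =>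
    mul_nonneg (sectorMultiplicity_nonneg k)
      (mul_nonneg (pow_nonneg (by linarith) _) (pow_nonneg (by linarith) _))
  have hA := sum_sectorProb_le_of_le (N := N) (p := p) (u := w - 1 / 2) (A := A) (by linarith) hp1 ht
    (Finset.filter_subset _ _) (fun k hk => (Finset.mem_filter.1 hk).2)
  have hB := sum_sectorProb_le_of_ge (N := N) (u := w) (A := B) hp hp1 ht
    (Finset.filter_subset _ _) (fun k hk => (Finset.mem_filter.1 hk).2)
  refine le_trans ?_ (add_le_add hA hB)
  -- Sectors of multiplicity zero are missing from `windowIndices` even inside the window; they have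
  -- probability zero and are dropped first.
  calc _ = ∑ k ∈ (Finset.range (N / 2 + 1) \ windowIndices N c w).filter
            (fun k => sectorProb N p k ≠ 0), sectorProb N p k := (Finset.sum_filter_ne_zero _).symm
    _ ≤ ∑ k ∈ A ∪ B, sectorProb N p k := by
        refine Finset.sum_le_sum_of_subset_of_nonneg ?_ fun k _ _ => h0 k
        intro k hk
        rw [Finset.mem_filter, Finset.mem_sdiff, windowIndices, Finset.mem_filter] at hk
        obtain ⟨⟨h1, h2⟩, h3⟩ := hk
        have h4 : sectorMultiplicity N k ≠ 0 := by
          intro h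
          exact h3 (by simp [sectorProb, h])
        have h5 : ¬ |(N : ℝ) / 2 - k - c| ≤ w := fun h => h2 ⟨h1, h, h4⟩
        rw [abs_le, not_and_or, not_le, not_le] at h5
        rw [Finset.mem_union, Finset.mem_filter, Finset.mem_filter]
        rcases h5 with h5 | h5
        · exact Or.inl ⟨h1, by rw [hc] at h5; linarith⟩
        · exact Or.inr ⟨h1, by rw [hc] at h5; linarith⟩
    _ ≤ _ := by
        rw [← Finset.sum_union_inter]
        exact le_add_of_nonneg_right (Finset.sum_nonneg fun k _ => h0 k)

/-! ### Dimension of the kept sectors. -/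

lemma card_windowIndices_le (c : ℝ) {w : ℝ} (hw : 0 ≤ w) :
    ((windowIndices N c w).card : ℝ) ≤ 2 * w + 1 := by
  set a := (N : ℝ) / 2 - c with ha
  have h1 : (windowIndices N c w).card ≤ (Finset.Icc ⌈a - w⌉ ⌊a + w⌋).card := by
    refine Finset.card_le_card_of_injOn (fun k : ℕ => (k : ℤ)) ?_ (Nat.cast_injective.injOn)
    intro k hk
    have h := (Finset.mem_filter.1 hk).2.1
    rw [abs_le] at h
    rw [Finset.mem_coe, Finset.mem_Icc, Int.ceil_le, Int.le_floor]
    push_cast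
    constructor <;> linarith [h.1, h.2]
  have h2 : ((Finset.Icc ⌈a - w⌉ ⌊a + w⌋).card : ℝ) ≤ 2 * w + 1 := by
    rw [Int.card_Icc]
    have h3 : ((⌊a + w⌋ + 1 - ⌈a - w⌉ : ℤ) : ℝ) ≤ 2 * w + 1 := by
      push_cast
      linarith [Int.floor_le (a + w), Int.le_ceil (a - w)]
    rcases le_total 0 (⌊a + w⌋ + 1 - ⌈a - w⌉) with h | h
    · rw [← Int.cast_natCast, Int.toNat_of_nonneg h]
      exact h3
    · rw [Int.toNat_of_nonpos h]
      push_cast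
      linarith
  exact (Nat.cast_le.2 h1).trans h2

lemma sum_dim_windowIndices_le {c w : ℝ} (hc : 0 ≤ c) (hw : 0 ≤ w) :
    ((∑ k ∈ windowIndices N c w, (N - 2 * k + 1) : ℕ) : ℝ) ≤
      (2 * w + 1) * (2 * (c + w) + 1) := by
  rw [Nat.cast_sum]
  have h1 : ∀ k ∈ windowIndices N c w, ((N - 2 * k + 1 : ℕ) : ℝ) ≤ 2 * (c + w) + 1 := by
    intro k hk
    have h := (Finset.mem_filter.1 hk)
    have h2 : 2 * k ≤ N := by
      have := Finset.mem_range.1 h.1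
      omega
    have h3 := (abs_le.1 h.2.1).2
    push_cast [h2]
    linarith
  refine (Finset.sum_le_card_nsmul _ _ _ h1).trans ?_
  rw [nsmul_eq_mul]
  exact mul_le_mul_of_nonneg_right (card_windowIndices_le c hw) (by linarith)

end Estimates

/-! ### Asymptotics of the tail, the dimension and the number of qubits. -/

section Asymptotics

open Filter Topology

lemma tendsto_inv_sqrt_natCast : Tendsto (fun N : ℕ => (√ (N : ℝ))⁻¹) atTop (𝓝 0) :=
  tendsto_inv_atTop_zero.comp (Real.tendsto_sqrt_atTop.comp tendsto_natCast_atTop_atTop)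

/-- The value `t = 4w/N` minimises `N t²/8 - t w`, giving `-2w²/N = -(9/8) L`, strictly below `-L`.
The gap absorbs the offset 1/2 and the prefactor, both negligible as `t → 0`. -/
lemma eventually_tail_lt {p L : ℝ} (hp : 1 / 2 < p) (hL : 0 < L) :
    ∀ᶠ N : ℕ in atTop, ∀ t w : ℝ, w = 3 / 4 * √ (N * L) → t = 4 * w / N →
      Real.exp (N * t ^ 2 / 8 - t * (w - 1 / 2)) +
        (1 - (1 - p) / p * Real.exp (-t)) / (1 - (1 - p) / p) * Real.exp (N * t ^ 2 / 8 - t * w) <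
      2 * Real.exp (-L) := by
  set x := (1 - p) / p with hx
  have hx1 : 0 < 1 - x := by
    rw [hx, sub_pos, div_lt_one (by linarith)]; linarith
  -- The tail as a continuous function of `h = 1/√N`, where `t = 3 √L h`.
  let g : ℝ → ℝ := fun h => Real.exp (-(9 / 8 * L) + 3 / 2 * √ L * h) +
    (1 - x * Real.exp (-(3 * √ L * h))) / (1 - x) * Real.exp (-(9 / 8 * L))
  have hg : Continuous g := by
    have : (1 - x) ≠ 0 := hx1.ne'
    fun_prop
  have hg0 : g 0 < 2 * Real.exp (-L) := by
    simp only [g, mul_zero, add_zero, neg_zero, Real.exp_zero, mul_one, div_self hx1.ne', one_mul]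
    rw [← two_mul]
    refine mul_lt_mul_of_pos_left (Real.exp_lt_exp.2 (by linarith)) two_pos
  have hlim := (hg.tendsto 0).comp tendsto_inv_sqrt_natCast
  filter_upwards [hlim.eventually_lt_const hg0, eventually_gt_atTop 0] with N hN hN0 t w hw ht
  refine lt_of_eq_of_lt ?_ hN
  have hr : 0 < √ (N : ℝ) := Real.sqrt_pos.2 (Nat.cast_pos.2 hN0)
  set r := √ (N : ℝ) with hrdef
  have hrN : (N : ℝ) = r ^ 2 := (Real.sq_sqrt (Nat.cast_nonneg N)).symm
  have hw' : w = 3 / 4 * (r * √ L) := by rw [hw, Real.sqrt_mul (Nat.cast_nonneg N)]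
  have ht' : t = 3 * √ L * r⁻¹ := by
    rw [ht, hw', hrN]; field_simp
  have hL2 : √ L ^ 2 = L := Real.sq_sqrt hL.le
  have e1 : N * t ^ 2 / 8 - t * w = -(9 / 8 * L) := by
    have : N * t ^ 2 / 8 - t * w = -(9 / 8 * √ L ^ 2) := by
      rw [hrN, ht', hw']
      field_simp
      ring
    rw [this, hL2]
  have e2 : N * t ^ 2 / 8 - t * (w - 1 / 2) = -(9 / 8 * L) + 3 / 2 * √ L * r⁻¹ := by
    rw [← e1, ht']
    ring
  rw [e2, e1, ht']
  rfl

lemma eventually_dim_le {p L : ℝ} (hp : 1 / 2 < p) (hL : 0 < L) :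
    ∀ᶠ N : ℕ in atTop, ∀ w : ℝ, w = 3 / 4 * √ (N * L) →
      (2 * w + 1) * (2 * ((p - 1 / 2) * (N + 1) + w) + 1) ≤
        2 * (2 * p - 1) * √ L * (N * √ N) := by
  -- The left side divided by `N √N`, with `h = 1/√N`. Its value `(3/2)(2p - 1)√L` at 0 is below the
  -- allowed `2(2p - 1)√L`.
  let g : ℝ → ℝ := fun h => (3 / 2 * √ L + h) *
    ((2 * p - 1) * (1 + h ^ 2) + 3 / 2 * √ L * h + h ^ 2)
  have hg : Continuous g := by fun_prop
  have hg0 : g 0 < 2 * (2 * p - 1) * √ L := by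
    have : 0 < √ L := Real.sqrt_pos.2 hL
    simp only [g]
    nlinarith [mul_pos this (by linarith : 0 < 2 * p - 1)]
  have hlim := (hg.tendsto 0).comp tendsto_inv_sqrt_natCast
  filter_upwards [hlim.eventually_lt_const hg0, eventually_gt_atTop 0] with N hN hN0 w hw
  have hr : 0 < √ (N : ℝ) := Real.sqrt_pos.2 (Nat.cast_pos.2 hN0)
  simp only [Function.comp_apply] at hN
  have hw' : w = 3 / 4 * (√ (N : ℝ) * √ L) := by rw [hw, Real.sqrt_mul (Nat.cast_nonneg N)]
  have hrN : (N : ℝ) = √ (N : ℝ) ^ 2 := (Real.sq_sqrt (Nat.cast_nonneg N)).symm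
  set r := √ (N : ℝ) with hrdef
  rw [hw', hrN]
  have h1 := mul_le_mul_of_nonneg_right hN.le (pow_pos hr 3).le
  refine le_trans (le_of_eq ?_) (h1.trans (le_of_eq ?_))
  · simp only [g]
    field_simp
    ring
  · ring

/-- Rounding the exponent down to an integer loses a factor of at most 2, which turns the constant 4
into 2. -/
lemma eventually_exists_qubits {p L : ℝ} (hp : 1 / 2 < p) (hL : 0 < L) :
    ∀ᶠ N : ℕ in atTop, ∃ n : ℕ,
      (n : ℝ) ≤ 3 / 2 * Real.logb 2 N + Real.logb 2 (4 * (2 * p - 1) * √ L) ∧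
      2 * (2 * p - 1) * √ L * (N * √ N) ≤ 2 ^ n := by
  have hB : 0 < 4 * (2 * p - 1) * √ L :=
    mul_pos (mul_pos four_pos (by linarith)) (Real.sqrt_pos.2 hL)
  have hlim : Tendsto (fun N : ℕ => 3 / 2 * Real.logb 2 N + Real.logb 2 (4 * (2 * p - 1) * √ L))
      atTop atTop :=
    tendsto_atTop_add_const_right _ _ (Tendsto.const_mul_atTop (by norm_num)
      ((Real.tendsto_logb_atTop one_lt_two).comp tendsto_natCast_atTop_atTop))
  filter_upwards [hlim.eventually_ge_atTop 0, eventually_gt_atTop 0] with N hN hN0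
  refine ⟨_, Nat.floor_le hN, ?_⟩
  set y := 3 / 2 * Real.logb 2 N + Real.logb 2 (4 * (2 * p - 1) * √ L) with hy
  have hNpos : (0 : ℝ) < N := Nat.cast_pos.2 hN0
  have h1 : (2 : ℝ) ^ y = N * √ N * (4 * (2 * p - 1) * √ L) := by
    rw [hy, Real.rpow_add two_pos, Real.rpow_logb two_pos (by norm_num) hB, mul_comm (3 / 2 : ℝ),
      Real.rpow_mul two_pos.le, Real.rpow_logb two_pos (by norm_num) hNpos, Real.sqrt_eq_rpow (N : ℝ),
      show (3 / 2 : ℝ) = 1 + 1 / 2 by norm_num, Real.rpow_add hNpos, Real.rpow_one]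
  have h2 : (2 : ℝ) ^ y ≤ 2 ^ (⌊y⌋₊ + 1) := by
    rw [← Real.rpow_natCast]
    refine Real.rpow_le_rpow_of_exponent_le one_le_two ?_
    push_cast
    exact (Nat.lt_floor_add_one y).le
  rw [h1, pow_succ] at h2
  linarith

end Asymptotics

/-! ### The protocol on the sectors of the window. -/

section Protocol

variable {N : ℕ}

lemma sectorProjector_eq_projMatrix (N : ℕ) (S : Set ℝ) :
    sectorProjector N S = projMatrix (⨆ j ∈ S, spinSector N j) := rfl

/-- Only the inclusion of the ladder in the eigenspace of `J²` is needed, not that the ladders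
exhaust it. -/
lemma sectorProjector_mul_ladder {S : Set ℝ} {k : ℕ} (hk : (N : ℝ) / 2 - k ∈ S) (i : ℕ) :
    sectorProjector N S * ladder N k i = ladder N k i := by
  rw [sectorProjector_eq_projMatrix]
  refine projMatrix_mul_eq fun v => ?_
  refine (le_iSup₂_of_le (f := fun j (_ : j ∈ S) => spinSector N j) _ hk le_rfl) ?_
  rw [spinSector, Module.End.mem_eigenspace_iff, ← LinearMap.comp_apply,
    ← Matrix.toLpLin_mul_same, totalSpinSq_mul_ladder, map_smul, LinearMap.smul_apply]
  congr 1
  push_cast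
  rfl

/-- Compression of the `N`-copy ensemble into the sectors of a window that has smaller width than
the window that the encoder is required to keep. -/
theorem exists_sector_compression {p c w w' : ℝ} (hp : 0 ≤ p) (hp1 : p ≤ 1) (hw : w ≤ w') {n : ℕ}
    (hn : ∑ k ∈ windowIndices N c w, (N - 2 * k + 1) ≤ 2 ^ n) :
    ∃ (E : Op N →ₗ[ℂ] Op n) (D : Op n →ₗ[ℂ] Op N), IsChannel E ∧ IsChannel D ∧
      KeepsOnlySectors (spinWindow N c w') E ∧
      ∀ v : BlochSphere, traceNorm (tensorPower N (qubitState p v) -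
          D (E (tensorPower N (qubitState p v)))) / 2 ≤
        ∑ k ∈ Finset.range (N / 2 + 1) \ windowIndices N c w, sectorProb N p k := by
  set S := windowIndices N c w with hSdef
  have hS : ∀ k ∈ S, 2 * k ≤ N := fun k hk => by
    have := Finset.mem_range.1 (windowIndices_subset c w hk)
    omega
  -- The index is a sector with a rung in it; the block map is the first projection, and there are
  -- `2j + 1` rungs per sector.
  let F : (Σ k : S, Fin (N - 2 * k.1 + 1)) → Op N := fun a => ladder N a.1 a.2
  have hF : ∀ a b, (F a)ᴴ * F b = if a = b then highestWeightProj N a.1 else 0 := by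
    rintro ⟨⟨k, hk⟩, i⟩ ⟨⟨l, hl⟩, j⟩
    change (ladder N k i)ᴴ * ladder N l j = _
    rw [ladder_conjTranspose_mul (hS k hk) (hS l hl) (Nat.lt_succ_iff.1 i.2)]
    by_cases hkl : k = l
    · subst hkl
      simp [Fin.ext_iff]
    · rw [if_neg fun h => hkl h.1, if_neg]
      intro h
      exact hkl (congrArg (fun a : Σ k : S, Fin (N - 2 * k.1 + 1) => a.1.1) h)
  have hsum : ∑ a, F a * (F a)ᴴ = ladderProj N S := by
    rw [Fintype.sum_sigma, ladderProj, ← Finset.sum_coe_sort S]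
    refine Finset.sum_congr rfl fun k _ => ?_
    exact Fin.sum_univ_eq_sum_range (fun i => ladder N k i * (ladder N k i)ᴴ) _
  have hcard : Fintype.card (Σ k : S, Fin (N - 2 * k.1 + 1)) ≤ Fintype.card (Qubits n) := by
    rw [Fintype.card_sigma]
    simp only [Fintype.card_fin, Fintype.card_pi, Finset.prod_const, Finset.card_univ]
    rw [Finset.sum_coe_sort S fun k => N - 2 * k + 1]
    exact hn
  obtain ⟨E, D, hE, hD, ⟨ρ₀, hρ₀, hkeep⟩, herr⟩ := exists_compression (π := Sigma.fst)
    (P := fun k : S => highestWeightProj N k) hF (fun a => ladder_mul_highestWeightProj _ _)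
    (fun k => by
      rw [highestWeightProj_trace]
      have h1 := (Finset.mem_filter.1 k.2).2.2
      exact_mod_cast lt_of_le_of_ne (sectorMultiplicity_nonneg _) (Ne.symm h1))
    hcard (fun _ => 0) (fun _ => 0)
  refine ⟨E, D, hE, hD, ⟨ρ₀, hρ₀, ?_⟩, fun v => ?_⟩
  · refine hkeep _ (projMatrix_conjTranspose _) (projMatrix_mul_self _) ?_
    rintro ⟨⟨k, hk⟩, i⟩
    exact sectorProjector_mul_ladder (S := spinWindow N c w')
      ⟨⟨k, hS k hk, rfl⟩, (Finset.mem_filter.1 hk).2.1.trans hw⟩ i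
  · have hR : ∀ k : S, ∃ R : ℕ → ℕ → ℂ, ∀ i ∈ Finset.range (N - 2 * k.1 + 1),
        tensorPower N (qubitState p v) * ladder N k i =
          ∑ j ∈ Finset.range (N - 2 * k.1 + 1), R j i • ladder N k j :=
      fun k => spinAlgebra_le_ladderSubalgebra (hS k k.2) (tensorPower_qubitState_mem p v)
    choose R hR using hR
    have h := herr _ (fun a b => if a.1 = b.1 then R b.1 a.2 b.2 else 0)
      (tensorPower_qubitState_posSemidef hp hp1 v) (fun a b hab => by
        by_contra hne
        exact hab (if_neg hne)) (fun b => by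
        rw [Fintype.sum_sigma, Finset.sum_eq_single b.1]
        · simp only [if_true]
          change _ * ladder N b.1 b.2 = _
          rw [hR b.1 b.2 (Finset.mem_range.2 b.2.2)]
          exact (Fin.sum_univ_eq_sum_range (fun j => R b.1 j b.2 • ladder N b.1 j) _).symm
        · intro k _ hk
          simp [hk]
        · simp)
    rw [hsum, one_sub_ladderProj_mul_trace (windowIndices_subset c w)] at h
    exact h

end Protocol

end

theorem theorem2 (ε : ℝ) (hε : 0 < ε) (hε2 : ε < 2)
    (p : ℝ) (hp : 1 / 2 < p) (hp1 : p < 1)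
    (μ : Measure BlochSphere) [IsProbabilityMeasure μ]
    (hcomplete : ∀ U : Set BlochSphere, IsOpen U → U.Nonempty → 0 < μ U) :
    ∃ N₀ : ℕ, 0 < N₀ ∧ ∀ N : ℕ, N₀ ≤ N →
      ∃ (n : ℕ) (E : Op N →ₗ[ℂ] Op n) (D : Op n →ₗ[ℂ] Op N),
        (n : ℝ) ≤ 3 / 2 * Real.logb 2 N
            + Real.logb 2 (4 * (2 * p - 1) * √(Real.log (2 / ε))) ∧
          IsChannel E ∧ IsChannel D ∧
          KeepsOnlySectors
            (spinWindow N ((p - 1 / 2) * (N + 1)) √(N * Real.log (2 / ε))) E ∧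
          averageError p μ E D < ε := by
  set L := Real.log (2 / ε) with hLdef
  have hL : 0 < L := Real.log_pos (by rwa [lt_div_iff₀ hε, one_mul])
  have hexp : 2 * Real.exp (-L) = ε := by
    rw [hLdef, ← Real.log_inv, Real.exp_log (by positivity)]
    field_simp
  obtain ⟨N₁, hN₁⟩ := Filter.eventually_atTop.1 ((eventually_tail_lt hp hL).and
    ((eventually_dim_le hp hL).and (eventually_exists_qubits hp hL)))
  refine ⟨N₁ + 1, Nat.succ_pos _, fun N hN => ?_⟩
  obtain ⟨htail, hdim, n, hn, hn2⟩ := hN₁ N (by omega)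
  -- The factor must lie strictly between `1/√2` (for the tail) and 1 (for the dimension).
  set w := 3 / 4 * √ (N * L) with hw
  have hw0 : 0 ≤ w := by positivity
  have hwle : w ≤ √ (N * L) := by
    have := Real.sqrt_nonneg (N * L)
    linarith
  have hc : 0 ≤ (p - 1 / 2) * ((N : ℝ) + 1) := mul_nonneg (by linarith) (by positivity)
  have hcap : ∑ k ∈ windowIndices N ((p - 1 / 2) * (N + 1)) w, (N - 2 * k + 1) ≤ 2 ^ n := by
    have h := (sum_dim_windowIndices_le (N := N) hc hw0).trans ((hdim w rfl).trans hn2)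
    exact_mod_cast h
  obtain ⟨E, D, hE, hD, hkeep, herr⟩ :=
    exists_sector_compression (p := p) (by linarith) hp1.le hwle hcap
  refine ⟨n, E, D, hn, hE, hD, hkeep, ?_⟩
  have ht := htail (4 * w / N) w rfl rfl
  have hsum := sum_sectorProb_compl_windowIndices_le (N := N) (w := w) hp hp1.le
    (t := 4 * w / N) (by positivity)
  rw [hexp] at ht
  refine lt_of_le_of_lt ?_ (lt_of_le_of_lt hsum ht)
  -- The error bound is uniform in the Bloch vector, so the average against a probability measure
  -- obeys it too.
  calc averageError p μ E D ≤ ∫ _, (∑ k ∈ Finset.range (N / 2 + 1) \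
        windowIndices N ((p - 1 / 2) * (N + 1)) w, sectorProb N p k) ∂μ := by
        refine integral_mono_of_nonneg (Filter.Eventually.of_forall fun v => ?_)
          (integrable_const _) (Filter.Eventually.of_forall herr)
        exact div_nonneg (Finset.sum_nonneg fun i _ => Real.sqrt_nonneg _) two_pos.le
    _ = _ := by simp
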